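/- Let $S_0$ be a finite nonempty set, $\mathbb{H}=\{-1,0,1\}$, $\mathbb{H}_+=\{0,1\}$, and consider a discrete-time 2d-QBD process on $\mathbb{Z}_+^2\times S_0$, given by nonnegative $S_0\times S_0$ matrices $A_{i,j}$ ($i,j\in\mathbb{H}$), $A^{(1)}_{i,j}$ ($i\in\mathbb{H},j\in\mathbb{H}_+$), $A^{(2)}_{i,j}$ ($i\in\mathbb{H}_+,j\in\mathbb{H}$), $A^{(0)}_{i,j}$ ($i,j\in\mathbb{H}_+$), which contain the transition probabilities for the level increment $(i,j)$ in the interior, on the $x_1$-axis off the origin, on the $x_2$-axis off the origin, and at the origin, respectively; each of the sums $\sum_{i,j} A_{i,j}$, $\sum_{i,j} A^{(1)}_{i,j}$, $\sum_{i,j} A^{(2)}_{i,j}$, $\sum_{i,j} A^{(0)}_{i,j}$ is a stochastic matrix. Assume that the three Markov chains obtained by removing boundaries are irreducible and aperiodic: the chain on $\mathbb{Z}^2\times S_0$ with blocks $A_{i,j}$; the chain on $\mathbb{Z}\times\mathbb{Z}_+\times S_0$ with blocks $A_{i,j}$ where $x_2\neq 0$ and $A^{(1)}_{i,j}$ where $x_2=0$;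 the chain on $\mathbb{Z}_+\times\mathbb{Z}\times S_0$ with blocks $A_{i,j}$ where $x_1\ne 0$ and $A^{(2)}_{i,j}$ where $x_1=0$. For $z,w>0$ let $A_{*,j}(z)=\sum_{i\in\mathbb{H}}A_{i,j}z^i$, $A_{i,*}(w)=\sum_{j\in\mathbb{H}}A_{i,j}w^j$, $A^{(1)}_{*,j}(z)=\sum_{i\in\mathbb{H}}A^{(1)}_{i,j}z^i$, $A^{(2)}_{i,*}(w)=\sum_{j\in\mathbb{H}}A^{(2)}_{i,j}w^j$, and let $\chi(z,w)$ be the spectral radius of $\sum_{i,j\in\mathbb{H}}A_{i,j}z^iw^j$. Let $\bar\Gamma=\{(s_1,s_2)\in\mathbb{R}^2:\chi(e^{s_1},e^{s_2})\le 1\}$ and, for $i\in\{1,2\}$, let $\log\underline{z}_i^*$ and $\log\bar z_i^*$ be the minimum and the maximum of $s_i$ over $\bar\Gamma$. For matrices $B_{-1},B_0,B_1$ let $G$ and $R$ be the (entrywise) minimum nonnegative solutions of $B_{-1}+B_0X+B_1X^2=X$ and $X^2B_{-1}+XB_0+B_1=X$, respectively, and let $N=\sum_{n\ge 0}\sum B_{i_1}B_{i_2}\cdots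 B_{i_n}$, where the inner sum is over all $(i_1,\dots,i_n)\in\mathbb{H}^n$ with $i_1+\dots+i_k\ge 0$ for $1\le k\le n-1$ and $i_1+\dots+i_n=0$ (the term $n=0$ is $I$). Write $G_1(z),R_1(z),N_1(z)$ for these matrices when $B_j=A_{*,j}(z)$, and $G_2(w),R_2(w),N_2(w)$ when $B_i=A_{i,*}(w)$. Let $C_1(z)=A^{(1)}_{*,0}(z)+A^{(1)}_{*,1}(z)G_1(z)$ and $C_2(w)=A^{(2)}_{0,*}(w)+A^{(2)}_{1,*}(w)G_2(w)$, and let $\psi_1(z)$ and $\psi_2(w)$ be their spectral radii. By Perron–Frobenius left and right eigenvectors of a nonnegative matrix we mean a nonnegative row vector $u$ and a nonnegative column vector $v$ with $uv=1$ that are eigenvectors for the eigenvalue equal to the spectral radius. (i) Let $z_0\in[\underline{z}_1^*,\bar z_1^*]$ with $\psi_1(z_0)=1$. Then $G_1(z_0)$ and $R_1(z_0)$ exist, the series $N_1(z_0)$ converges, $C_1(z_0)$ has Perron–Frobenius left and right eigenvectors with $uv=1$, and for every such pair $u=u^{C_1}(z_0)$, $v=v^{C_1}(z_0)$ the vector $u^{C_1}(z_0)$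 and, for every integer $k\ge 0$, the vector $$u^{C_1}(z_0)\,A^{(1)}_{*,1}(z_0)\,N_1(z_0)\,R_1(z_0)^k$$ are strictly positive (all entries are positive). (ii) Let $w_0\in[\underline{z}_2^*,\bar z_2^*]$ with $\psi_2(w_0)=1$. Then $G_2(w_0)$ and $R_2(w_0)$ exist, the series $N_2(w_0)$ converges, $C_2(w_0)$ has Perron–Frobenius left and right eigenvectors with $uv=1$, and for every such pair $u=u^{C_2}(w_0)$, $v=v^{C_2}(w_0)$ the vector $u^{C_2}(w_0)$ and, for every integer $k\ge 0$, the vector $$u^{C_2}(w_0)\,A^{(2)}_{1,*}(w_0)\,N_2(w_0)\,R_2(w_0)^k$$ are strictly positive. -/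

import Mathlib

open scoped Matrix

/-- The set `{-1, 0, 1}` of possible one-step increments. -/
def stepH : Finset ℤ := {-1, 0, 1}

/-- The set `{0, 1}` of possible one-step increments at a boundary. -/
def stepHPos : Finset ℤ := {0, 1}

/-- The spectral radius of a square real matrix: the maximum modulus of its complex eigenvalues. -/
noncomputable def spr {S : Type*} [Fintype S] [DecidableEq S] (M : Matrix S S ℝ) : ℝ :=
  (spectralRadius ℂ (M.map (fun x : ℝ => (x : ℂ)))).toReal

/-- `u` and `v` are Perron-Frobenius left and right eigenvectors of the nonnegative matrix `M`
(nonnegative eigenvectors for the eigenvalue `spr M`), normalized by `u v = 1`. -/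
structure IsPerronPair {S : Type*} [Fintype S] [DecidableEq S] (M : Matrix S S ℝ)
    (u v : S → ℝ) : Prop where
  left_nonneg : ∀ j, 0 ≤ u j
  right_nonneg : ∀ j, 0 ≤ v j
  left_eigen : u ᵥ* M = spr M • u
  right_eigen : M *ᵥ v = spr M • v
  normalized : u ⬝ᵥ v = 1

/-! ### Irreducibility and aperiodicity of a transition matrix on an arbitrary state space -/

/-- `y` can be reached from `x` in exactly `n` steps of positive probability. -/
def ReachIn {X : Type*} (P : X → X → ℝ) : ℕ → X → X → Prop
  | 0, x, y => x = y
  | n + 1, x, y => ∃ w, 0 < P x w ∧ ReachIn P n w y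

/-- Every state can be reached from every state. -/
def ChainIrreducible {X : Type*} (P : X → X → ℝ) : Prop :=
  ∀ x y, ∃ n, ReachIn P n x y

/-- Every state has period one: the only common divisor of its possible return times is `1`. -/
def ChainAperiodic {X : Type*} (P : X → X → ℝ) : Prop :=
  ∀ x, ∀ d : ℕ, (∀ n, 1 ≤ n → ReachIn P n x x → d ∣ n) → d = 1

/-! ### The matrices `G`, `R`, `N` of a triple `B (-1)`, `B 0`, `B 1` of matrices -/

/-- `X` is the (entrywise) minimum nonnegative solution of the matrix equation `E X`. -/
def IsMinNonnegSolution {S : Type*} (E : Matrix S S ℝ → Prop) (X : Matrix S S ℝ) : Prop :=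
  (∀ i j, 0 ≤ X i j) ∧ E X ∧
    ∀ Y : Matrix S S ℝ, (∀ i j, 0 ≤ Y i j) → E Y → ∀ i j, X i j ≤ Y i j

/-- `X` is the minimum nonnegative solution of `B₋₁ + B₀ X + B₁ X² = X`. -/
def IsGMatrix {S : Type*} [Fintype S] [DecidableEq S] (B : ℤ → Matrix S S ℝ)
    (X : Matrix S S ℝ) : Prop :=
  IsMinNonnegSolution (fun Y => B (-1) + B 0 * Y + B 1 * Y ^ 2 = Y) X

/-- `X` is the minimum nonnegative solution of `X² B₋₁ + X B₀ + B₁ = X`. -/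
def IsRMatrix {S : Type*} [Fintype S] [DecidableEq S] (B : ℤ → Matrix S S ℝ)
    (X : Matrix S S ℝ) : Prop :=
  IsMinNonnegSolution (fun Y => Y ^ 2 * B (-1) + Y * B 0 + B 1 = Y) X

/-- The minimum nonnegative solution of `B₋₁ + B₀ X + B₁ X² = X` (arbitrary if there is none). -/
noncomputable def gMatrix {S : Type*} [Fintype S] [DecidableEq S] (B : ℤ → Matrix S S ℝ) :
    Matrix S S ℝ :=
  Classical.epsilon (IsGMatrix B)

/-- The minimum nonnegative solution of `X² B₋₁ + X B₀ + B₁ = X` (arbitrary if there is none). -/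
noncomputable def rMatrix {S : Type*} [Fintype S] [DecidableEq S] (B : ℤ → Matrix S S ℝ) :
    Matrix S S ℝ :=
  Classical.epsilon (IsRMatrix B)

/-- The step sequences `(i₁, …, iₙ)` in `{-1, 0, 1}ⁿ` all of whose proper partial sums are
nonnegative and whose total is `0`. (The partial sum for `k = 0` is empty.) -/
def pathSet (n : ℕ) : Finset (Fin n → ℤ) :=
  (Fintype.piFinset fun _ : Fin n => stepH).filter fun i =>
    (∀ k : Fin n, 0 ≤ ∑ l : Fin n with l < k, i l) ∧ ∑ l, i l = 0

/-- The sum of `B i₁ * B i₂ * ⋯ * B iₙ` over the step sequences of `pathSet n`;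
for `n = 0` it is the identity matrix. -/
noncomputable def qMatrix {S : Type*} [Fintype S] [DecidableEq S] (B : ℤ → Matrix S S ℝ)
    (n : ℕ) : Matrix S S ℝ :=
  ∑ i ∈ pathSet n, (List.ofFn fun l : Fin n => B (i l)).prod

/-- The matrix `N = ∑ₙ Q⁽ⁿ⁾`. -/
noncomputable def nMatrix {S : Type*} [Fintype S] [DecidableEq S] (B : ℤ → Matrix S S ℝ) :
    Matrix S S ℝ :=
  ∑' n : ℕ, qMatrix B n

/-! ### Two-dimensional quasi-birth-and-death processes -/

/-- The transition blocks of a discrete-time 2d-QBD process on `ℤ₊² × S`, with `S` the finite set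
of phases: `A i j` in the interior, `A1 i j` on the `x₁`-axis, `A2 i j` on the `x₂`-axis and
`A0 i j` at the origin, where `(i, j)` is the increment of the level. Only the values at the
increments listed in the fields matter. -/
structure TwoDQBD (S : Type*) [Fintype S] where
  A : ℤ → ℤ → Matrix S S ℝ
  A1 : ℤ → ℤ → Matrix S S ℝ
  A2 : ℤ → ℤ → Matrix S S ℝ
  A0 : ℤ → ℤ → Matrix S S ℝ
  A_nonneg : ∀ i ∈ stepH, ∀ j ∈ stepH, ∀ s t, 0 ≤ A i j s t
  A1_nonneg : ∀ i ∈ stepH, ∀ j ∈ stepHPos, ∀ s t, 0 ≤ A1 i j s t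
  A2_nonneg : ∀ i ∈ stepHPos, ∀ j ∈ stepH, ∀ s t, 0 ≤ A2 i j s t
  A0_nonneg : ∀ i ∈ stepHPos, ∀ j ∈ stepHPos, ∀ s t, 0 ≤ A0 i j s t
  A_stochastic : ∀ s, ∑ t, (∑ i ∈ stepH, ∑ j ∈ stepH, A i j) s t = 1
  A1_stochastic : ∀ s, ∑ t, (∑ i ∈ stepH, ∑ j ∈ stepHPos, A1 i j) s t = 1
  A2_stochastic : ∀ s, ∑ t, (∑ i ∈ stepHPos, ∑ j ∈ stepH, A2 i j) s t = 1
  A0_stochastic : ∀ s, ∑ t, (∑ i ∈ stepHPos, ∑ j ∈ stepHPos, A0 i j) s t = 1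

namespace TwoDQBD

/-- Transition probabilities of the chain on `ℤ × ℤ × S` obtained by removing both boundaries. -/
def chainInt {S : Type*} [Fintype S] (q : TwoDQBD S) (x y : ℤ × ℤ × S) : ℝ :=
  if y.1 - x.1 ∈ stepH ∧ y.2.1 - x.2.1 ∈ stepH then
    q.A (y.1 - x.1) (y.2.1 - x.2.1) x.2.2 y.2.2
  else 0

/-- Transition probabilities of the chain on `ℤ × ℤ₊ × S` obtained by removing the boundary on the
`x₂`-axis. -/
def chainOne {S : Type*} [Fintype S] (q : TwoDQBD S) (x y : ℤ × ℕ × S) : ℝ :=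
  if x.2.1 ≠ 0 then
    if y.1 - x.1 ∈ stepH ∧ (y.2.1 : ℤ) - x.2.1 ∈ stepH then
      q.A (y.1 - x.1) ((y.2.1 : ℤ) - x.2.1) x.2.2 y.2.2
    else 0
  else
    if y.1 - x.1 ∈ stepH ∧ (y.2.1 : ℤ) - x.2.1 ∈ stepHPos then
      q.A1 (y.1 - x.1) ((y.2.1 : ℤ) - x.2.1) x.2.2 y.2.2
    else 0

/-- Transition probabilities of the chain on `ℤ₊ × ℤ × S` obtained by removing the boundary on the
`x₁`-axis. -/
def chainTwo {S : Type*} [Fintype S] (q : TwoDQBD S) (x y : ℕ × ℤ × S) : ℝ :=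
  if x.1 ≠ 0 then
    if (y.1 : ℤ) - x.1 ∈ stepH ∧ y.2.1 - x.2.1 ∈ stepH then
      q.A ((y.1 : ℤ) - x.1) (y.2.1 - x.2.1) x.2.2 y.2.2
    else 0
  else
    if (y.1 : ℤ) - x.1 ∈ stepHPos ∧ y.2.1 - x.2.1 ∈ stepH then
      q.A2 ((y.1 : ℤ) - x.1) (y.2.1 - x.2.1) x.2.2 y.2.2
    else 0

/-- `A_{*,j}(z) = ∑_{i ∈ {-1,0,1}} A_{i,j} zⁱ`. -/
noncomputable def Acol {S : Type*} [Fintype S] (q : TwoDQBD S) (z : ℝ) (j : ℤ) : Matrix S S ℝ :=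
  ∑ i ∈ stepH, z ^ i • q.A i j

/-- `A_{i,*}(w) = ∑_{j ∈ {-1,0,1}} A_{i,j} wʲ`. -/
noncomputable def Arow {S : Type*} [Fintype S] (q : TwoDQBD S) (w : ℝ) (i : ℤ) : Matrix S S ℝ :=
  ∑ j ∈ stepH, w ^ j • q.A i j

/-- `A⁽¹⁾_{*,j}(z) = ∑_{i ∈ {-1,0,1}} A⁽¹⁾_{i,j} zⁱ`, for `j ∈ {0, 1}`. -/
noncomputable def A1col {S : Type*} [Fintype S] (q : TwoDQBD S) (z : ℝ) (j : ℤ) : Matrix S S ℝ :=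
  ∑ i ∈ stepH, z ^ i • q.A1 i j

/-- `A⁽²⁾_{i,*}(w) = ∑_{j ∈ {-1,0,1}} A⁽²⁾_{i,j} wʲ`, for `i ∈ {0, 1}`. -/
noncomputable def A2row {S : Type*} [Fintype S] (q : TwoDQBD S) (w : ℝ) (i : ℤ) : Matrix S S ℝ :=
  ∑ j ∈ stepH, w ^ j • q.A2 i j

/-- `C(z₁, z₂) = ∑_{i,j ∈ {-1,0,1}} A_{i,j} z₁ⁱ z₂ʲ`. -/
noncomputable def C {S : Type*} [Fintype S] (q : TwoDQBD S) (z₁ z₂ : ℝ) : Matrix S S ℝ :=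
  ∑ i ∈ stepH, ∑ j ∈ stepH, (z₁ ^ i * z₂ ^ j) • q.A i j

/-- `χ(z₁, z₂)`, the spectral radius of `C(z₁, z₂)`. -/
noncomputable def chi {S : Type*} [Fintype S] [DecidableEq S] (q : TwoDQBD S) (z₁ z₂ : ℝ) : ℝ :=
  spr (q.C z₁ z₂)

/-- The set of `(s₁, s₂)` with `χ(exp s₁, exp s₂) ≤ 1`. -/
def Gam {S : Type*} [Fintype S] [DecidableEq S] (q : TwoDQBD S) : Set (ℝ × ℝ) :=
  {s | q.chi (Real.exp s.1) (Real.exp s.2) ≤ 1}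

/-- The lower end `exp (min s₁)` of the range of `z₁`, the minimum being taken over `q.Gam`. -/
noncomputable def zLow1 {S : Type*} [Fintype S] [DecidableEq S] (q : TwoDQBD S) : ℝ :=
  Real.exp (sInf (Prod.fst '' q.Gam))

/-- The upper end `exp (max s₁)` of the range of `z₁`. -/
noncomputable def zHigh1 {S : Type*} [Fintype S] [DecidableEq S] (q : TwoDQBD S) : ℝ :=
  Real.exp (sSup (Prod.fst '' q.Gam))

/-- The lower end `exp (min s₂)` of the range of `z₂`. -/
noncomputable def zLow2 {S : Type*} [Fintype S] [DecidableEq S] (q : TwoDQBD S) : ℝ :=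
  Real.exp (sInf (Prod.snd '' q.Gam))

/-- The upper end `exp (max s₂)` of the range of `z₂`. -/
noncomputable def zHigh2 {S : Type*} [Fintype S] [DecidableEq S] (q : TwoDQBD S) : ℝ :=
  Real.exp (sSup (Prod.snd '' q.Gam))

/-- `C₁(z, G₁(z)) = A⁽¹⁾_{*,0}(z) + A⁽¹⁾_{*,1}(z) G₁(z)`. -/
noncomputable def C1 {S : Type*} [Fintype S] [DecidableEq S] (q : TwoDQBD S) (z : ℝ) :
    Matrix S S ℝ :=
  q.A1col z 0 + q.A1col z 1 * gMatrix (q.Acol z)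

/-- `C₂(G₂(w), w) = A⁽²⁾_{0,*}(w) + A⁽²⁾_{1,*}(w) G₂(w)`. -/
noncomputable def C2 {S : Type*} [Fintype S] [DecidableEq S] (q : TwoDQBD S) (w : ℝ) :
    Matrix S S ℝ :=
  q.A2row w 0 + q.A2row w 1 * gMatrix (q.Arow w)

/-- `ψ₁(z)`, the spectral radius of `C₁(z, G₁(z))`. -/
noncomputable def psi1 {S : Type*} [Fintype S] [DecidableEq S] (q : TwoDQBD S) (z : ℝ) : ℝ :=
  spr (q.C1 z)

/-- `ψ₂(w)`, the spectral radius of `C₂(G₂(w), w)`. -/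
noncomputable def psi2 {S : Type*} [Fintype S] [DecidableEq S] (q : TwoDQBD S) (w : ℝ) : ℝ :=
  spr (q.C2 w)

end TwoDQBD

/-! The key is to find, for each admissible `z`, some `w > 0` and a strictly positive `h` with `C(z,
w) h ≤ h`. At points of the region `χ ≤ 1`, normalized resolvents accumulate at such a vector, and
irreducibility makes it positive. In logarithmic coordinates the triples `(s₁, s₂, log h)`,
normalized at one phase, form a compact convex set: each constraint bounds a sum of exponentials of
affine functions, and irreducibility bounds every coordinate. The set contains `0` by stochasticity,
so its projection to `s₁` is an interval covering the whole range of `z`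
(`exists_pos_subinvariant`); no convexity of `χ` is needed.

From `h` come the objects. The bound `X h ≤ w h` is preserved by the iteration defining `G`. A
positive left subinvariant vector gives `R` by transposition. Since `w ^ (a + 1) * h` is
superharmonic for the level process killed on leaving the nonnegative levels, the total weight of
excursions is bounded, which gives `N`.

Positivity rests on `boundary_positivity`. Write an invariant `u` of `C₁` as `u = u A⁽¹⁾_{*,0} + (u
A⁽¹⁾_{*,1}) G` and follow a path of the reflected chain starting in the support of `u`. An axis step
or a completed excursion leads back into the support. An unfinished excursion at level `k + 1` is a
path from level `0` to level `k` starting in the support of `u A⁽¹⁾_{*,1}`, and such a path makes an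
entry of `N R ^ k` positive (`nMatrix_mul_pow_pos_of_path`). The second axis follows by exchanging
coordinates. -/

/-! ### Perron–Frobenius theory through resolvents -/

section PerronFrobenius

open Filter Topology

variable {S : Type*} [Fintype S]

theorem mulVec_mono {M : Matrix S S ℝ} (hM : ∀ i j, 0 ≤ M i j) {x y : S → ℝ}
    (h : ∀ i, x i ≤ y i) (i : S) : (M *ᵥ x) i ≤ (M *ᵥ y) i :=
  Finset.sum_le_sum fun j _ => mul_le_mul_of_nonneg_left (h j) (hM i j)

theorem mulVec_entry_nonneg {M : Matrix S S ℝ} (hM : ∀ i j, 0 ≤ M i j) {x : S → ℝ}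
    (h : ∀ i, 0 ≤ x i) (i : S) : 0 ≤ (M *ᵥ x) i :=
  Finset.sum_nonneg fun j _ => mul_nonneg (hM i j) (h j)

theorem hasSum_mulVec_entry {f : ℕ → Matrix S S ℝ} {T : Matrix S S ℝ} (hf : HasSum f T)
    (y : S → ℝ) (i : S) : HasSum (fun n => (f n *ᵥ y) i) ((T *ᵥ y) i) := by
  simp only [Matrix.mulVec, dotProduct]
  refine hasSum_sum fun j _ => HasSum.mul_right _ ?_
  exact (Pi.hasSum.1 ((Pi.hasSum.1 hf) i)) j

variable [DecidableEq S]

theorem pow_entry_nonneg {M : Matrix S S ℝ} (hM : ∀ i j, 0 ≤ M i j) (n : ℕ) (i j : S) :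
    0 ≤ (M ^ n) i j := by
  induction n generalizing i j with
  | zero => rw [pow_zero, Matrix.one_apply]; split_ifs <;> norm_num
  | succ n ih =>
    rw [pow_succ, Matrix.mul_apply]
    exact Finset.sum_nonneg fun k _ => mul_nonneg (ih i k) (hM k j)

theorem pow_mulVec_le {M : Matrix S S ℝ} (hM : ∀ i j, 0 ≤ M i j) {h : S → ℝ}
    (hh : ∀ i, (M *ᵥ h) i ≤ h i) (n : ℕ) (i : S) : (M ^ n *ᵥ h) i ≤ h i := by
  induction n generalizing i with
  | zero => simp
  | succ n ih =>
    rw [pow_succ', ← Matrix.mulVec_mulVec]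
    exact (mulVec_mono hM ih i).trans (hh i)

theorem le_pow_mulVec {M : Matrix S S ℝ} (hM : ∀ i j, 0 ≤ M i j) {h : S → ℝ}
    (hh : ∀ i, h i ≤ (M *ᵥ h) i) (n : ℕ) (i : S) : h i ≤ (M ^ n *ᵥ h) i := by
  induction n generalizing i with
  | zero => simp
  | succ n ih =>
    rw [pow_succ', ← Matrix.mulVec_mulVec]
    exact (hh i).trans (mulVec_mono hM ih i)

/-- Along `r → 1`, the normalized resolvents `(1 - r M)⁻¹ y` accumulate at a subinvariant vector
of `M`, which is invariant when `y ≤ M y`. -/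
theorem exists_subinvariant_of_summable {M : Matrix S S ℝ} (hM : ∀ i j, 0 ≤ M i j)
    (hs : ∀ r : ℝ, 0 < r → r < 1 → Summable fun n : ℕ => r ^ n • M ^ n)
    {y : S → ℝ} (hy : ∀ i, 0 ≤ y i) (hy0 : ∃ i, 0 < y i) :
    ∃ h : S → ℝ, (∀ i, 0 ≤ h i) ∧ ∑ i, h i = 1 ∧ (∀ i, (M *ᵥ h) i ≤ h i) ∧
      ((∀ i, y i ≤ (M *ᵥ y) i) → M *ᵥ h = h) := by
  have hY : 0 < ∑ i, y i := by
    obtain ⟨i, hi⟩ := hy0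
    exact Finset.sum_pos' (fun i _ => hy i) ⟨i, Finset.mem_univ i, hi⟩
  -- Any sequence in `(0, 1)` tending to `1` would serve; the shift by `2` keeps `r 0` positive.
  set r : ℕ → ℝ := fun k => 1 - 1 / ((k : ℝ) + 2) with hr
  have hr0 : ∀ k, 0 < r k := fun k => by
    have : 1 / ((k : ℝ) + 2) < 1 := by
      rw [div_lt_one (by positivity)]; linarith [(Nat.cast_nonneg k : (0 : ℝ) ≤ k)]
    simp only [hr]; linarith
  have hr1 : ∀ k, r k < 1 := fun k => by
    have : 0 < 1 / ((k : ℝ) + 2) := by positivity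
    simp only [hr]; linarith
  have hrlim : Tendsto r atTop (𝓝 1) := by
    have h1 : Tendsto (fun k : ℕ => 1 / ((k : ℝ) + 2)) atTop (𝓝 0) :=
      Tendsto.div_atTop tendsto_const_nhds
        (tendsto_atTop_add_const_right _ _ tendsto_natCast_atTop_atTop)
    simpa [hr] using (tendsto_const_nhds (x := (1 : ℝ))).sub h1
  set T : ℕ → Matrix S S ℝ := fun k => ∑' n : ℕ, r k ^ n • M ^ n with hT
  have hTs : ∀ k, HasSum (fun n : ℕ => r k ^ n • M ^ n) (T k) := fun k =>
    (hs (r k) (hr0 k) (hr1 k)).hasSum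
  have hTeq : ∀ k, T k = 1 + r k • (M * T k) := fun k => by
    have h1 := (hs (r k) (hr0 k) (hr1 k)).tsum_eq_zero_add
    have h2 : ∀ n : ℕ, r k ^ (n + 1) • M ^ (n + 1) = (r k • M) * (r k ^ n • M ^ n) := fun n => by
      rw [smul_mul_smul_comm, pow_succ', pow_succ']
    simp only [h2] at h1
    rw [(hs (r k) (hr0 k) (hr1 k)).tsum_mul_left] at h1
    simpa using h1
  set g : ℕ → S → ℝ := fun k => T k *ᵥ y with hg
  have hgeq : ∀ k i, g k i = y i + r k * (M *ᵥ g k) i := fun k i => by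
    have : g k = y + r k • (M *ᵥ g k) := by
      conv_lhs => rw [hg]
      simp only
      rw [hTeq k, Matrix.add_mulVec, Matrix.one_mulVec, Matrix.smul_mulVec,
        ← Matrix.mulVec_mulVec]
    exact congrFun this i
  have hg0 : ∀ k i, 0 ≤ g k i := fun k i => by
    refine HasSum.nonneg (fun n => ?_) (hasSum_mulVec_entry (hTs k) y i)
    rw [Matrix.smul_mulVec]
    exact mul_nonneg (pow_nonneg (hr0 k).le _) (mulVec_entry_nonneg (pow_entry_nonneg hM n) hy i)
  have hgy : ∀ k i, y i ≤ g k i := fun k i => by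
    rw [hgeq k i]
    have := mul_nonneg (hr0 k).le (mulVec_entry_nonneg hM (hg0 k) i)
    linarith
  set a : ℕ → ℝ := fun k => ∑ i, g k i with ha
  have haY : ∀ k, ∑ i, y i ≤ a k := fun k => Finset.sum_le_sum fun i _ => hgy k i
  have ha0 : ∀ k, 0 < a k := fun k => hY.trans_le (haY k)
  have hmem : ∀ k, (fun i => g k i / a k) ∈ stdSimplex ℝ S := fun k =>
    ⟨fun i => div_nonneg (hg0 k i) (ha0 k).le, by
      rw [← Finset.sum_div]; exact div_self (ha0 k).ne'⟩
  obtain ⟨h, hh, φ, hφ, hlim⟩ := (isCompact_stdSimplex ℝ S).tendsto_subseq hmem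
  have hlim' : ∀ i, Tendsto (fun k => g (φ k) i / a (φ k)) atTop (𝓝 (h i)) := fun i =>
    (tendsto_pi_nhds.1 hlim) i
  have hrφ := hrlim.comp hφ.tendsto_atTop
  have hMlim : ∀ i, Tendsto (fun k => r (φ k) * (M *ᵥ fun i => g (φ k) i / a (φ k)) i) atTop
      (𝓝 ((M *ᵥ h) i)) := fun i => by
    have : Tendsto (fun k => (M *ᵥ fun i => g (φ k) i / a (φ k)) i) atTop (𝓝 ((M *ᵥ h) i)) :=
      tendsto_finsetSum _ fun j _ => (hlim' j).const_mul _
    simpa using hrφ.mul this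
  -- After dividing `g = y + r M g` by the mass `a`, the defect from invariance is `y / a`, which is
  -- nonnegative.
  have hkey : ∀ k i, g k i / a k - r k * (M *ᵥ fun i => g k i / a k) i = y i / a k :=
    fun k i => by
      have h1 : (fun i => g k i / a k) = (a k)⁻¹ • g k := by
        ext i; simp [div_eq_inv_mul]
      rw [h1, Matrix.mulVec_smul, hgeq k i]
      simp only [Pi.smul_apply, smul_eq_mul]
      rw [← hgeq k i]
      have := hgeq k i
      have hne := (ha0 k).ne'
      field_simp
      linarith
  have hdiff : ∀ i, Tendsto (fun k => y i / a (φ k)) atTop (𝓝 (h i - (M *ᵥ h) i)) := fun i => by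
    have := (hlim' i).sub (hMlim i)
    simp only [hkey] at this
    exact this
  refine ⟨h, hh.1, hh.2, fun i => ?_, fun hsub => ?_⟩
  · have := ge_of_tendsto' (hdiff i) fun k => div_nonneg (hy i) (ha0 (φ k)).le
    linarith
  -- If `y ≤ M y`, then `y ≤ M ^ n y` for all `n`, so the mass grows at least like `(1 - r k)⁻¹` and
  -- the defect tends to zero.
  · have hlow : ∀ k, (∑ i, y i) * (1 - r k)⁻¹ ≤ a k := fun k => by
      rw [ha, Finset.sum_mul]
      refine Finset.sum_le_sum fun i _ => ?_
      refine hasSum_le (fun n => ?_)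
        ((hasSum_geometric_of_lt_one (hr0 k).le (hr1 k)).mul_left (y i))
        (hasSum_mulVec_entry (hTs k) y i)
      rw [Matrix.smul_mulVec, mul_comm]
      exact mul_le_mul_of_nonneg_left (le_pow_mulVec hM hsub n i) (pow_nonneg (hr0 k).le _)
    have hup : ∀ i k, y i / a k ≤ (1 - r k) := fun i k => by
      have h1 : 0 < 1 - r k := by linarith [hr1 k]
      rw [div_le_iff₀ (ha0 k)]
      have h2 := mul_le_mul_of_nonneg_left (hlow k) h1.le
      have h3 : (1 - r k) * ((∑ i, y i) * (1 - r k)⁻¹) = ∑ i, y i := by field_simp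
      rw [h3] at h2
      exact (Finset.single_le_sum (fun i _ => hy i) (Finset.mem_univ i)).trans h2
    have hz : Tendsto (fun k => 1 - r (φ k)) atTop (𝓝 0) := by
      simpa using tendsto_const_nhds (x := (1 : ℝ)).sub hrφ
    ext i
    have h0 : Tendsto (fun k => y i / a (φ k)) atTop (𝓝 0) :=
      squeeze_zero (fun k => div_nonneg (hy i) (ha0 _).le) (fun k => hup i _) hz
    have := tendsto_nhds_unique h0 (hdiff i)
    linarith

section Spectral

attribute [local instance] Matrix.linftyOpNormedRing Matrix.linftyOpNormedAlgebra

theorem spectralRadius_eq_ofReal_spr (M : Matrix S S ℝ) :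
    spectralRadius ℂ (M.map (fun x : ℝ => (x : ℂ))) = ENNReal.ofReal (spr M) := by
  rw [spr, ENNReal.ofReal_toReal]
  exact ((spectrum.spectralRadius_le_pow_nnnorm_pow_one_div ℂ _ 0).trans_lt (by
    simpa using ENNReal.mul_lt_top ENNReal.coe_lt_top ENNReal.coe_lt_top)).ne

/-- The resolvent `(1 - ζ M)⁻¹` is holomorphic on every disc of radius below `1`, so its Taylor
series, which is the Neumann series, converges there even when the norm of `M` exceeds `1`. -/
theorem summable_smul_pow_of_spr_le_one {M : Matrix S S ℝ} (h : spr M ≤ 1) {r : ℝ}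
    (hr0 : 0 < r) (hr1 : r < 1) : Summable fun n : ℕ => r ^ n • M ^ n := by
  have hle : spectralRadius ℂ (M.map (fun x : ℝ => (x : ℂ))) ≤ 1 := by
    rw [spectralRadius_eq_ofReal_spr]; simpa using h
  obtain ⟨r', hr', hr'1⟩ := exists_between (show r.toNNReal < 1 by simpa using hr1)
  have h1 := (spectrum.hasFPowerSeriesOnBall_inverse_one_sub_smul ℂ
    (M.map (fun x : ℝ => (x : ℂ)))).exchange_radius
      ((spectrum.differentiableOn_inverse_one_sub_smul (r := r')
        (lt_of_lt_of_le (by exact_mod_cast hr'1) (ENNReal.one_le_inv.2 hle))).hasFPowerSeriesOnBall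
          (pos_of_gt hr'))
  have hmem : (r : ℂ) ∈ Metric.eball (0 : ℂ) r' := by
    rw [Metric.mem_eball, edist_zero_right, ← ofReal_norm, Complex.norm_real,
      Real.norm_of_nonneg hr0.le]
    exact ENNReal.coe_lt_coe.2 hr'
  have h2 := (h1.hasSum hmem).summable
  have hmap : ∀ n : ℕ, (M.map (fun x : ℝ => (x : ℂ))) ^ n
      = (M ^ n).map (fun x : ℝ => (x : ℂ)) := fun n =>
    (map_pow (RingHom.mapMatrix Complex.ofRealHom) M n).symm
  refine Pi.summable.2 fun i => Pi.summable.2 fun j => ?_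
  have h3 := Pi.summable.1 (Pi.summable.1 h2 i) j
  rw [← Complex.summable_ofReal]
  refine h3.congr fun n => ?_
  simp [hmap, Matrix.smul_apply]

theorem exists_norm_eq_spr [Nonempty S] (M : Matrix S S ℝ) :
    ∃ k ∈ spectrum ℂ (M.map (fun x : ℝ => (x : ℂ))), ‖k‖ = spr M := by
  obtain ⟨k, hk, hk'⟩ :=
    spectrum.exists_nnnorm_eq_spectralRadius (M.map (fun x : ℝ => (x : ℂ)))
  refine ⟨k, hk, ?_⟩
  rw [spr, ← hk']; simp

end Spectral

theorem spr_transpose (M : Matrix S S ℝ) : spr Mᵀ = spr M := by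
  have : spectrum ℂ ((Mᵀ).map (fun x : ℝ => (x : ℂ)))
      = spectrum ℂ (M.map (fun x : ℝ => (x : ℂ))) := by
    ext k
    rw [Matrix.mem_spectrum_iff_isRoot_charpoly, Matrix.mem_spectrum_iff_isRoot_charpoly,
      Matrix.transpose_map, Matrix.charpoly_transpose]
  simp only [spr, spectralRadius, this]

/-- The modulus of an eigenvector for an eigenvalue of maximal modulus. -/
theorem exists_spr_smul_le_mulVec [Nonempty S] {M : Matrix S S ℝ} (hM : ∀ i j, 0 ≤ M i j) :
    ∃ y : S → ℝ, (∀ i, 0 ≤ y i) ∧ (∃ i, 0 < y i) ∧ ∀ i, spr M * y i ≤ (M *ᵥ y) i := by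
  obtain ⟨k, hk, hk'⟩ := exists_norm_eq_spr M
  rw [← Matrix.spectrum_toLin', ← Module.End.hasEigenvalue_iff_mem_spectrum] at hk
  obtain ⟨x, hx⟩ := hk.exists_hasEigenvector
  refine ⟨fun i => ‖x i‖, fun i => norm_nonneg _, ?_, fun i => ?_⟩
  · by_contra! hcon
    refine hx.2 (funext fun i => ?_)
    simpa using hcon i
  · have h1 := congrFun hx.apply_eq_smul i
    rw [Matrix.toLin'_apply] at h1
    rw [← hk']
    have h2 : ‖k‖ * ‖x i‖ = ‖∑ j, (M i j : ℂ) * x j‖ := by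
      rw [← norm_mul, ← smul_eq_mul, ← Pi.smul_apply, ← h1]; rfl
    rw [h2]
    refine (norm_sum_le _ _).trans (Finset.sum_le_sum fun j _ => ?_)
    rw [norm_mul, Complex.norm_real, Real.norm_of_nonneg (hM i j)]

/-- The modulus `y` of an eigenvector of maximal modulus satisfies `y ≤ M y`, which is the case
where the resolvent limit is invariant. -/
theorem exists_invariant_of_spr_eq_one [Nonempty S] {M : Matrix S S ℝ} (hM : ∀ i j, 0 ≤ M i j)
    (h1 : spr M = 1) : ∃ h : S → ℝ, (∀ i, 0 ≤ h i) ∧ ∑ i, h i = 1 ∧ M *ᵥ h = h := by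
  obtain ⟨y, hy, hy0, hyM⟩ := exists_spr_smul_le_mulVec hM
  obtain ⟨h, hh, hsum, -, hinv⟩ := exists_subinvariant_of_summable hM
    (fun r hr0 hr1 => summable_smul_pow_of_spr_le_one h1.le hr0 hr1) hy hy0
  exact ⟨h, hh, hsum, hinv fun i => by simpa [h1] using hyM i⟩

/-- A nonnegative matrix with a positive right subinvariant vector has a nonzero nonnegative left
subinvariant vector. -/
theorem exists_left_subinvariant [Nonempty S] {M : Matrix S S ℝ} (hM : ∀ i j, 0 ≤ M i j)
    {h : S → ℝ} (hpos : ∀ i, 0 < h i) (hh : ∀ i, (M *ᵥ h) i ≤ h i) :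
    ∃ p : S → ℝ, (∀ i, 0 ≤ p i) ∧ ∑ i, p i = 1 ∧ ∀ i, (p ᵥ* M) i ≤ p i := by
  -- From `M ^ n h ≤ h` the entry `(i, j)` of `M ^ n` is at most `h i / h j` for every `n`, so no
  -- spectral information is needed.
  have hs : ∀ r : ℝ, 0 < r → r < 1 → Summable fun n : ℕ => r ^ n • Mᵀ ^ n := by
    intro r hr0 hr1
    refine Pi.summable.2 fun j => Pi.summable.2 fun i => ?_
    refine Summable.of_nonneg_of_le (fun n => ?_) (fun n => ?_)
      ((summable_geometric_of_lt_one hr0.le hr1).mul_right (h i / h j))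
    · rw [← Matrix.transpose_pow]
      exact mul_nonneg (pow_nonneg hr0.le _) (pow_entry_nonneg hM n i j)
    · rw [← Matrix.transpose_pow]
      refine mul_le_mul_of_nonneg_left ?_ (pow_nonneg hr0.le _)
      rw [Matrix.transpose_apply, le_div_iff₀ (hpos j)]
      exact (Finset.single_le_sum (f := fun j => (M ^ n) i j * h j)
        (fun j _ => mul_nonneg (pow_entry_nonneg hM n i j) (hpos j).le)
        (Finset.mem_univ j)).trans (pow_mulVec_le hM hh n i)
  obtain ⟨p, hp, hsum, hsub, -⟩ := exists_subinvariant_of_summable (M := Mᵀ) (y := fun _ => 1)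
    (fun i j => hM j i) hs (fun _ => zero_le_one) ⟨Classical.arbitrary S, one_pos⟩
  exact ⟨p, hp, hsum, fun i => by simpa [Matrix.mulVec_transpose] using hsub i⟩

theorem pos_of_subinvariant {M : Matrix S S ℝ}
    (hM : ∀ i j, 0 ≤ M i j) (hirr : ∀ i j, ∃ n, 0 < (M ^ n) i j) {h : S → ℝ}
    (h0 : ∀ i, 0 ≤ h i) (hsum : ∑ i, h i = 1) (hh : ∀ i, (M *ᵥ h) i ≤ h i) (i : S) : 0 < h i := by
  obtain ⟨j, -, hj⟩ : ∃ j ∈ Finset.univ, 0 < h j := by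
    by_contra! hcon
    linarith [Finset.sum_nonpos hcon]
  obtain ⟨n, hn⟩ := hirr i j
  refine lt_of_lt_of_le ?_ (pow_mulVec_le hM hh n i)
  exact Finset.sum_pos' (fun k _ => mul_nonneg (pow_entry_nonneg hM n i k) (h0 k))
    ⟨j, Finset.mem_univ j, mul_pos hn hj⟩

end PerronFrobenius

/-! ### Increments and entrywise inequalities -/

theorem mem_stepH {j : ℤ} : j ∈ stepH ↔ j = -1 ∨ j = 0 ∨ j = 1 := by
  simp [stepH]

theorem sum_stepH {M : Type*} [AddCommMonoid M] (f : ℤ → M) :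
    ∑ j ∈ stepH, f j = f (-1) + f 0 + f 1 := by
  rw [stepH, Finset.sum_insert (by decide), Finset.sum_insert (by decide), Finset.sum_singleton,
    add_assoc]

theorem one_entry_nonneg {S : Type*} [DecidableEq S] (i j : S) : (0 : ℝ) ≤ (1 : Matrix S S ℝ) i j := by
  rw [Matrix.one_apply]; split_ifs <;> norm_num

section NonnegMatrix

variable {S : Type*} [Fintype S]

theorem mul_entry_nonneg {M N : Matrix S S ℝ} (hM : ∀ i j, 0 ≤ M i j) (hN : ∀ i j, 0 ≤ N i j)
    (i j : S) : 0 ≤ (M * N) i j :=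
  Finset.sum_nonneg fun k _ => mul_nonneg (hM i k) (hN k j)

theorem mul_entry_pos {M N : Matrix S S ℝ} (hM : ∀ i j, 0 ≤ M i j) (hN : ∀ i j, 0 ≤ N i j)
    {i j k : S} (h1 : 0 < M i j) (h2 : 0 < N j k) : 0 < (M * N) i k :=
  Finset.sum_pos' (fun l _ => mul_nonneg (hM i l) (hN l k))
    ⟨j, Finset.mem_univ j, mul_pos h1 h2⟩

theorem vecMul_entry_pos {u : S → ℝ} {M : Matrix S S ℝ} (hu : ∀ i, 0 ≤ u i)
    (hM : ∀ i j, 0 ≤ M i j) {i j : S} (h1 : 0 < u i) (h2 : 0 < M i j) : 0 < (u ᵥ* M) j :=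
  Finset.sum_pos' (fun l _ => mul_nonneg (hu l) (hM l j))
    ⟨i, Finset.mem_univ i, mul_pos h1 h2⟩

theorem vecMul_entry_nonneg {u : S → ℝ} {M : Matrix S S ℝ} (hu : ∀ i, 0 ≤ u i)
    (hM : ∀ i j, 0 ≤ M i j) (j : S) : 0 ≤ (u ᵥ* M) j :=
  Finset.sum_nonneg fun l _ => mul_nonneg (hu l) (hM l j)

theorem mul_entry_mono {M M' N N' : Matrix S S ℝ} (hM : ∀ i j, 0 ≤ M i j)
    (hN : ∀ i j, 0 ≤ N i j) (h1 : ∀ i j, M i j ≤ M' i j) (h2 : ∀ i j, N i j ≤ N' i j) (i j : S) :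
    (M * N) i j ≤ (M' * N') i j :=
  Finset.sum_le_sum fun k _ =>
    mul_le_mul (h1 i k) (h2 k j) (hN k j) ((hM i k).trans (h1 i k))

theorem mul_entry_le_left {M N N' : Matrix S S ℝ} (hM : ∀ i j, 0 ≤ M i j)
    (h : ∀ i j, N i j ≤ N' i j) (i j : S) : (M * N) i j ≤ (M * N') i j :=
  Finset.sum_le_sum fun k _ => mul_le_mul_of_nonneg_left (h k j) (hM i k)

theorem mul_entry_le_right {M M' N : Matrix S S ℝ} (hN : ∀ i j, 0 ≤ N i j)
    (h : ∀ i j, M i j ≤ M' i j) (i j : S) : (M * N) i j ≤ (M' * N) i j :=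
  Finset.sum_le_sum fun k _ => mul_le_mul_of_nonneg_right (h i k) (hN k j)

end NonnegMatrix

/-! ### Existence and positivity of `G` and `R` -/

section MinimalSolutions

open Filter Topology

/-- A monotone continuous map with bounded iterates from `0` has a minimal nonnegative fixed
point. -/
theorem exists_isMinNonnegSolution {S : Type*} {F : Matrix S S ℝ → Matrix S S ℝ}
    (hF0 : ∀ X, (∀ i j, 0 ≤ X i j) → ∀ i j, 0 ≤ F X i j)
    (hmono : ∀ X Y : Matrix S S ℝ, (∀ i j, 0 ≤ X i j) → (∀ i j, X i j ≤ Y i j) →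
      ∀ i j, F X i j ≤ F Y i j)
    (hcont : Continuous F) {c : S → S → ℝ} (hb : ∀ n i j, (F^[n] 0) i j ≤ c i j) :
    ∃ X, IsMinNonnegSolution (fun Y => F Y = Y) X := by
  have hnn : ∀ n i j, 0 ≤ (F^[n] 0) i j := fun n => by
    induction n with
    | zero => intro i j; simp
    | succ n ih => rw [Function.iterate_succ_apply']; exact hF0 _ ih
  have hstep : ∀ n i j, (F^[n] 0) i j ≤ (F^[n + 1] 0) i j := fun n => by
    induction n with
    | zero => intro i j; simpa using hnn 1 i j
    | succ n ih =>
      intro i j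
      rw [Function.iterate_succ_apply', Function.iterate_succ_apply' _ (n + 1)]
      exact hmono _ _ (hnn n) ih i j
  have hM : ∀ i j, Monotone fun n => (F^[n] 0) i j := fun i j =>
    monotone_nat_of_le_succ fun n => hstep n i j
  have hlim : ∀ i j, ∃ x, Tendsto (fun n => (F^[n] 0) i j) atTop (𝓝 x) := fun i j =>
    ⟨_, tendsto_atTop_ciSup (hM i j) ⟨c i j, by rintro _ ⟨n, rfl⟩; exact hb n i j⟩⟩
  choose X hX using hlim
  have hX' : Tendsto (fun n => F^[n] 0) atTop (𝓝 (X : Matrix S S ℝ)) :=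
    tendsto_pi_nhds.2 fun i => tendsto_pi_nhds.2 fun j => hX i j
  refine ⟨X, fun i j => ge_of_tendsto' (hX i j) fun n => hnn n i j, ?_, fun Y hY hFY i j => ?_⟩
  · have h1 := (hcont.tendsto X).comp hX'
    have h2 := hX'.comp (tendsto_add_atTop_nat 1)
    refine tendsto_nhds_unique h1 (h2.congr fun n => ?_)
    simp only [Function.comp_apply, Function.iterate_succ_apply']
  · refine le_of_tendsto' (hX i j) fun n => ?_
    suffices h : ∀ i j, (F^[n] 0) i j ≤ Y i j from h i j
    induction n with
    | zero => simpa using hY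
    | succ n ih =>
      rw [Function.iterate_succ_apply', ← hFY]
      exact hmono _ _ (hnn n) ih

variable {S : Type*} [Fintype S] [DecidableEq S]

variable {B : ℤ → Matrix S S ℝ}

/-- The iterates from `0` keep the bound `X h ≤ w h`, which limits each entry by `w * h i / h j`
because `h` is positive. -/
theorem exists_isGMatrix (hB : ∀ j ∈ stepH, ∀ s t, 0 ≤ B j s t) {w : ℝ} (hw : 0 < w)
    {h : S → ℝ} (hpos : ∀ i, 0 < h i)
    (hh : ∀ s, ∑ j ∈ stepH, w ^ j * (B j *ᵥ h) s ≤ h s) : ∃ X, IsGMatrix B X := by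
  have b1 := hB (-1) (by decide)
  have b2 := hB 0 (by decide)
  have b3 := hB 1 (by decide)
  have hF0 : ∀ X : Matrix S S ℝ, (∀ i j, 0 ≤ X i j) →
      ∀ i j, 0 ≤ (B (-1) + B 0 * X + B 1 * X ^ 2) i j := fun X hX i j =>
    add_nonneg (add_nonneg (b1 i j) (mul_entry_nonneg b2 hX i j))
      (mul_entry_nonneg b3 (pow_entry_nonneg hX 2) i j)
  refine exists_isMinNonnegSolution (F := fun X => B (-1) + B 0 * X + B 1 * X ^ 2)
    (c := fun i j => w * h i / h j) hF0 ?_ ?_ ?_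
  · intro X Y hX hXY i j
    refine add_le_add (add_le_add le_rfl (mul_entry_le_left b2 hXY i j))
      (mul_entry_le_left b3 (fun i j => ?_) i j)
    rw [pow_two, pow_two]
    exact mul_entry_mono hX hX hXY hXY i j
  · fun_prop
  · intro n
    suffices H : (∀ i j, 0 ≤ ((fun X => B (-1) + B 0 * X + B 1 * X ^ 2)^[n] 0) i j) ∧
        ∀ i, (((fun X => B (-1) + B 0 * X + B 1 * X ^ 2)^[n] 0) *ᵥ h) i ≤ w * h i by
      intro i j
      rw [le_div_iff₀ (hpos j)]
      exact (Finset.single_le_sum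
        (f := fun j => ((fun X => B (-1) + B 0 * X + B 1 * X ^ 2)^[n] 0) i j * h j)
        (fun j _ => mul_nonneg (H.1 i j) (hpos j).le) (Finset.mem_univ j)).trans (H.2 i)
    induction n with
    | zero => exact ⟨by simp, fun i => by simpa using (mul_pos hw (hpos i)).le⟩
    | succ n ih =>
      rw [Function.iterate_succ_apply']
      generalize (fun X => B (-1) + B 0 * X + B 1 * X ^ 2)^[n] 0 = X at ih
      refine ⟨hF0 X ih.1, fun i => ?_⟩
      have h1 := mulVec_mono b2 (y := w • h) ih.2 i
      have h2 := mulVec_mono b3 (y := (w * w) • h) (x := X ^ 2 *ᵥ h) (fun i => by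
        have e1 := mulVec_mono ih.1 (y := w • h) ih.2 i
        have e2 := mul_le_mul_of_nonneg_left (ih.2 i) hw.le
        rw [Matrix.mulVec_smul] at e1
        simp only [Pi.smul_apply, smul_eq_mul] at e1 ⊢
        rw [pow_two, ← Matrix.mulVec_mulVec]
        linarith) i
      have h3 := mul_le_mul_of_nonneg_left (hh i) hw.le
      rw [sum_stepH] at h3
      -- Multiplied by `w`, the subinvariance of `h` reads `B₋₁ h + w B₀ h + w² B₁ h ≤ w h`, exactly
      -- what the induction step needs.
      rw [Matrix.mulVec_smul] at h1 h2
      simp only [Pi.smul_apply, smul_eq_mul, zpow_neg_one, zpow_zero, zpow_one] at h1 h2 h3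
      simp only [Matrix.add_mulVec, Pi.add_apply, ← Matrix.mulVec_mulVec]
      have h4 : w * (w⁻¹ * (B (-1) *ᵥ h) i + 1 * (B 0 *ᵥ h) i + w * (B 1 *ᵥ h) i)
          = (B (-1) *ᵥ h) i + w * (B 0 *ᵥ h) i + w * w * (B 1 *ᵥ h) i := by
        field_simp
      linarith

/-- Transposing reverses products; exchanging up and down steps as well turns one equation into the
other. -/
theorem isRMatrix_of_isGMatrix_transpose {X : Matrix S S ℝ}
    (hX : IsGMatrix (fun j => (B (-j))ᵀ) X) : IsRMatrix B Xᵀ := by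
  have key : ∀ Y : Matrix S S ℝ, (Y ^ 2 * B (-1) + Y * B 0 + B 1)ᵀ
      = (B (- -1))ᵀ + (B (-0))ᵀ * Yᵀ + (B (-1))ᵀ * Yᵀ ^ 2 := fun Y => by
    simp only [Matrix.transpose_add, Matrix.transpose_mul, Matrix.transpose_pow, neg_neg, neg_zero]
    abel
  obtain ⟨h0, h1, h2⟩ := hX
  refine ⟨fun i j => h0 j i, ?_, fun Y hY hE i j => h2 Yᵀ (fun i j => hY j i) ?_ j i⟩
  · apply Matrix.transpose_injective
    rw [key, Matrix.transpose_transpose]; exact h1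
  · show (B (- -1))ᵀ + (B (-0))ᵀ * Yᵀ + (B (-1))ᵀ * Yᵀ ^ 2 = Yᵀ
    rw [← key, hE]

theorem exists_isRMatrix (hB : ∀ j ∈ stepH, ∀ s t, 0 ≤ B j s t) {w : ℝ} (hw : 0 < w)
    {p : S → ℝ} (hpos : ∀ i, 0 < p i)
    (hp : ∀ s, ∑ j ∈ stepH, w ^ j * (p ᵥ* B j) s ≤ p s) : ∃ X, IsRMatrix B X := by
  obtain ⟨X, hX⟩ := exists_isGMatrix (B := fun j => (B (-j))ᵀ) (w := w⁻¹) (h := p)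
    (fun j hj s t => hB (-j) (by rw [mem_stepH] at hj ⊢; omega) t s) (inv_pos.2 hw) hpos
    (fun s => by
      refine le_trans (le_of_eq ?_) (hp s)
      simp only [sum_stepH, Matrix.mulVec_transpose]
      simp
      ring)
  exact ⟨Xᵀ, isRMatrix_of_isGMatrix_transpose hX⟩

/-- Entries of `G ^ (a + 1)` stand for passages from level `a` to level `-1`. Each of the three
terms of the equation for `G` is at most `G`, so a step followed by a passage is again a passage. -/
theorem IsGMatrix.pos_of_step {G : Matrix S S ℝ} (hG : IsGMatrix B G)
    (hB : ∀ j ∈ stepH, ∀ s t, 0 ≤ B j s t) {j : ℤ} (hj : j ∈ stepH) {a b : ℕ}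
    (hab : (b : ℤ) = a + j) {s t r : S} (h1 : 0 < B j s t) (h2 : 0 < (G ^ (b + 1)) t r) :
    0 < (G ^ (a + 1)) s r := by
  obtain ⟨h0, hE, -⟩ := hG
  have b1 := hB (-1) (by decide)
  have b2 := hB 0 (by decide)
  have b3 := hB 1 (by decide)
  have g2 := pow_entry_nonneg h0 2
  refine (mul_entry_pos (hB j hj) (pow_entry_nonneg h0 _) h1 h2).trans_le ?_
  have hle : ∀ s t, B (-1) s t ≤ G s t ∧ (B 0 * G) s t ≤ G s t ∧ (B 1 * G ^ 2) s t ≤ G s t :=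
    fun s t => by
      have e := congrFun (congrFun hE s) t
      simp only [Matrix.add_apply] at e
      have e1 := b1 s t
      have e2 := mul_entry_nonneg b2 h0 s t
      have e3 := mul_entry_nonneg b3 g2 s t
      exact ⟨by linarith, by linarith, by linarith⟩
  rcases mem_stepH.1 hj with rfl | rfl | rfl
  · obtain rfl : a = b + 1 := by omega
    rw [pow_succ' G (b + 1)]
    exact mul_entry_le_right (pow_entry_nonneg h0 _) (fun s t => (hle s t).1) s r
  · obtain rfl : a = b := by omega
    rw [pow_succ', ← mul_assoc]
    exact mul_entry_le_right (pow_entry_nonneg h0 _) (fun s t => (hle s t).2.1) s r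
  · obtain rfl : b = a + 1 := by omega
    rw [show a + 1 + 1 = 2 + a by omega, pow_add, ← mul_assoc, pow_succ' G a]
    exact mul_entry_le_right (pow_entry_nonneg h0 _) (fun s t => (hle s t).2.2) s r

theorem IsGMatrix.pos_of_down {G : Matrix S S ℝ} (hG : IsGMatrix B G)
    (hB : ∀ j ∈ stepH, ∀ s t, 0 ≤ B j s t) {s t : S} (h : 0 < B (-1) s t) : 0 < G s t := by
  obtain ⟨h0, hE, -⟩ := hG
  have e := congrFun (congrFun hE s) t
  simp only [Matrix.add_apply] at e
  have e2 := mul_entry_nonneg (hB 0 (by decide)) h0 s t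
  have e3 := mul_entry_nonneg (hB 1 (by decide)) (pow_entry_nonneg h0 2) s t
  linarith

/-- Here `R² B₋₁`, `R B₀` and `B₁` are all at most `R`, so a step into level `b` can be absorbed in
`R ^ b`. This requires `b ≠ 0`: steps into level `0` belong to `N`. -/
theorem IsRMatrix.pos_of_step {R M : Matrix S S ℝ} (hR : IsRMatrix B R)
    (hB : ∀ j ∈ stepH, ∀ s t, 0 ≤ B j s t) (hM : ∀ s t, 0 ≤ M s t) {j : ℤ} (hj : j ∈ stepH)
    {a b : ℕ} (hab : (b : ℤ) = a + j) (hb : b ≠ 0) {r s t : S} (h1 : 0 < (M * R ^ a) r s)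
    (h2 : 0 < B j s t) : 0 < (M * R ^ b) r t := by
  obtain ⟨h0, hE, -⟩ := hR
  have b1 := hB (-1) (by decide)
  have b2 := hB 0 (by decide)
  have b3 := hB 1 (by decide)
  have g2 := pow_entry_nonneg h0 2
  have hMR := fun k => mul_entry_nonneg hM (pow_entry_nonneg h0 k)
  refine (mul_entry_pos (hMR a) (hB j hj) h1 h2).trans_le ?_
  have hle : ∀ s t, (R ^ 2 * B (-1)) s t ≤ R s t ∧ (R * B 0) s t ≤ R s t ∧ B 1 s t ≤ R s t :=
    fun s t => by
      have e := congrFun (congrFun hE s) t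
      simp only [Matrix.add_apply] at e
      have e1 := b3 s t
      have e2 := mul_entry_nonneg h0 b2 s t
      have e3 := mul_entry_nonneg g2 b1 s t
      exact ⟨by linarith, by linarith, by linarith⟩
  obtain ⟨c, rfl⟩ := Nat.exists_eq_succ_of_ne_zero hb
  rw [Nat.succ_eq_add_one] at *
  rcases mem_stepH.1 hj with rfl | rfl | rfl
  · obtain rfl : a = c + 2 := by omega
    rw [pow_add, pow_succ R c, ← mul_assoc, ← mul_assoc, mul_assoc _ (R ^ 2)]
    exact mul_entry_le_left (hMR c) (fun s t => (hle s t).1) r t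
  · obtain rfl : a = c + 1 := by omega
    rw [pow_succ R c, ← mul_assoc, mul_assoc _ R]
    exact mul_entry_le_left (hMR c) (fun s t => (hle s t).2.1) r t
  · obtain rfl : a = c := by omega
    rw [pow_succ R a, ← mul_assoc]
    exact mul_entry_le_left (hMR a) (fun s t => (hle s t).2.2) r t

end MinimalSolutions

/-! ### Paths on nonnegative levels and the series `N` -/

section TabooPaths

variable {S : Type*} [Fintype S] [DecidableEq S]

/-- The total weight of the paths of length `n` from level `a` to level `b` all of whose levels
before the last are nonnegative. -/
noncomputable def tabooPow (B : ℤ → Matrix S S ℝ) : ℕ → ℤ → ℤ → Matrix S S ℝ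
  | 0, a, b => if a = b then 1 else 0
  | n + 1, a, b => if 0 ≤ a then ∑ j ∈ stepH, B j * tabooPow B n (a + j) b else 0

variable {B : ℤ → Matrix S S ℝ}

/-- Splitting off the first increment shifts the starting level; the constraint at `k = 0` becomes
`0 ≤ a`. -/
theorem tabooPow_eq_sum (n : ℕ) (a b : ℤ) :
    tabooPow B n a b = ∑ i ∈ (Fintype.piFinset fun _ : Fin n => stepH) with
      (∀ k : Fin n, 0 ≤ a + ∑ l : Fin n with l < k, i l) ∧ a + ∑ l, i l = b,
        (List.ofFn fun l : Fin n => B (i l)).prod := by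
  induction n generalizing a b with
  | zero =>
    simp only [tabooPow, Finset.sum_filter]
    simp
  | succ n ih =>
    have hcond : ∀ i : Fin (n + 1) → ℤ,
        ((∀ k : Fin (n + 1), 0 ≤ a + ∑ l : Fin (n + 1) with l < k, i l) ∧ a + ∑ l, i l = b) ↔
        0 ≤ a ∧ ((∀ k : Fin n, 0 ≤ (a + i 0) + ∑ l : Fin n with l < k, Fin.tail i l) ∧
          (a + i 0) + ∑ l, Fin.tail i l = b) := fun i => by
      rw [Fin.forall_fin_succ]
      simp only [Finset.sum_filter, Fin.sum_univ_succ, Fin.tail, Fin.succ_lt_succ_iff,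
        Fin.succ_pos, if_true, Fin.not_lt_zero, if_false, Finset.sum_const_zero, add_zero,
        add_assoc, and_assoc]
    simp only [tabooPow, ih, hcond]
    simp only [Finset.sum_filter]
    by_cases ha : 0 ≤ a
    · simp only [ha, if_true, true_and, Finset.mul_sum, mul_ite, mul_zero]
      rw [← Finset.sum_product']
      refine Finset.sum_nbij' (fun p => (Fin.cons p.1 p.2 : Fin (n + 1) → ℤ))
        (fun i => (i 0, Fin.tail i)) ?_ ?_ ?_ ?_ ?_
      · intro p hp
        rw [Finset.mem_product, Fintype.mem_piFinset] at hp
        rw [Fintype.mem_piFinset]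
        intro k
        refine Fin.cases ?_ (fun k => ?_) k
        · exact hp.1
        · exact hp.2 k
      · intro i hi
        rw [Fintype.mem_piFinset] at hi
        rw [Finset.mem_product, Fintype.mem_piFinset]
        exact ⟨hi 0, fun k => hi k.succ⟩
      · intro p _
        simp
      · intro i _
        simp
      · intro p _
        simp [List.ofFn_succ]
    · simp [ha]

theorem qMatrix_eq_tabooPow (n : ℕ) : qMatrix B n = tabooPow B n 0 0 := by
  simp only [tabooPow_eq_sum, qMatrix, pathSet, zero_add]

theorem tabooPow_nonneg (hB : ∀ j ∈ stepH, ∀ s t, 0 ≤ B j s t) (n : ℕ) (a b : ℤ) (s t : S) :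
    0 ≤ tabooPow B n a b s t := by
  induction n generalizing a s t with
  | zero => rw [tabooPow]; split_ifs; exacts [one_entry_nonneg s t, le_rfl]
  | succ n ih =>
    rw [tabooPow]
    split_ifs
    · rw [Matrix.sum_apply]
      exact Finset.sum_nonneg fun j hj => mul_entry_nonneg (hB j hj) (ih _) s t
    · exact le_rfl

/-- Concatenation yields only the paths that are at level `b` at time `n`, hence an inequality. -/
theorem tabooPow_mul_le (hB : ∀ j ∈ stepH, ∀ s t, 0 ≤ B j s t) (n m : ℕ) (a b c : ℤ) (s t : S) :
    (tabooPow B n a b * tabooPow B m b c) s t ≤ tabooPow B (n + m) a c s t := by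
  induction n generalizing a s t with
  | zero =>
    rw [tabooPow, zero_add]
    split_ifs with h
    · rw [one_mul, h]
    · rw [zero_mul]; exact tabooPow_nonneg hB m a c s t
  | succ n ih =>
    rw [show n + 1 + m = (n + m) + 1 by omega, tabooPow, tabooPow]
    split_ifs
    · rw [Finset.sum_mul, Matrix.sum_apply, Matrix.sum_apply]
      refine Finset.sum_le_sum fun j hj => ?_
      rw [mul_assoc]
      exact mul_entry_le_left (hB j hj) (ih _) s t
    · rw [zero_mul]

/-- One step of positive probability of the level process restricted to nonnegative levels. -/
def LevelStep (B : ℤ → Matrix S S ℝ) (x y : ℕ × S) : Prop :=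
  ∃ j ∈ stepH, (y.1 : ℤ) = x.1 + j ∧ 0 < B j x.2 y.2

theorem exists_tabooPow_pos (hB : ∀ j ∈ stepH, ∀ s t, 0 ≤ B j s t) {x y : ℕ × S}
    (h : Relation.ReflTransGen (LevelStep B) x y) :
    ∃ n, 0 < tabooPow B n x.1 y.1 x.2 y.2 := by
  induction h using Relation.ReflTransGen.head_induction_on with
  | refl => exact ⟨0, by simp [tabooPow]⟩
  | head hstep _ ih =>
    rename_i x z
    obtain ⟨n, hn⟩ := ih
    obtain ⟨j, hj, hz, hpos⟩ := hstep
    refine ⟨n + 1, ?_⟩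
    rw [tabooPow, if_pos (Int.natCast_nonneg _), Matrix.sum_apply]
    refine Finset.sum_pos' (fun j hj => mul_entry_nonneg (hB j hj) (tabooPow_nonneg hB n _ _) _ _)
      ⟨j, hj, ?_⟩
    rw [← hz]
    exact mul_entry_pos (hB j hj) (tabooPow_nonneg hB n _ _) hpos hn

/-- The function `w ^ (a + 1) * h` is superharmonic and equals `h` at level `-1`, so it dominates
the weight of exits through `-1`, each valued by `h`. The indicator accounts for a start already at
the exit level, which is what closes the induction. -/
theorem sum_tabooPow_mulVec_le (hB : ∀ j ∈ stepH, ∀ s t, 0 ≤ B j s t) {w : ℝ} (hw : 0 < w)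
    {h : S → ℝ} (hpos : ∀ i, 0 < h i)
    (hh : ∀ s, ∑ j ∈ stepH, w ^ j * (B j *ᵥ h) s ≤ h s) (L : ℕ) (a : ℤ) (ha : -1 ≤ a) (s : S) :
    ((∑ n ∈ Finset.range L, tabooPow B n a 0) *ᵥ (B (-1) *ᵥ h)) s + (if a = -1 then h s else 0)
      ≤ w ^ (a + 1) * h s := by
  induction L generalizing a s with
  | zero =>
    simp only [Finset.range_zero, Finset.sum_empty, Matrix.zero_mulVec, Pi.zero_apply, zero_add]
    split_ifs with h1
    · simp [h1]
    · exact mul_nonneg (zpow_nonneg hw.le _) (hpos s).le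
  | succ L ih =>
    rcases eq_or_lt_of_le ha with rfl | ha
    · have : ∑ n ∈ Finset.range (L + 1), tabooPow B n (-1) 0 = 0 :=
        Finset.sum_eq_zero fun n _ => by cases n <;> simp [tabooPow]
      simp [this]
    · have ha0 : 0 ≤ a := by omega
      have hrec : ∑ n ∈ Finset.range (L + 1), tabooPow B n a 0
          = ∑ j ∈ stepH, B j * ∑ n ∈ Finset.range L, tabooPow B n (a + j) 0
            + if a = 0 then 1 else 0 := by
        rw [Finset.sum_range_succ']
        simp only [tabooPow, ha0, if_true, Finset.mul_sum]
        rw [Finset.sum_comm]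
      -- The indicator survives only for `a = 0`, `j = -1`, where it supplies the path of length
      -- zero in `hrec`.
      have hbound : ∀ j ∈ stepH, (B j *ᵥ ((∑ n ∈ Finset.range L, tabooPow B n (a + j) 0) *ᵥ
          (B (-1) *ᵥ h))) s + (if a + j = -1 then (B j *ᵥ h) s else 0)
          ≤ w ^ (a + 1) * (w ^ j * (B j *ᵥ h) s) := fun j hj => by
        have h1 := mulVec_mono (hB j hj) (y := w ^ (a + j + 1) • h)
          (x := ((∑ n ∈ Finset.range L, tabooPow B n (a + j) 0) *ᵥ (B (-1) *ᵥ h)) +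
            (if a + j = -1 then h else 0)) (fun i => by
            have := ih (a + j) (by rw [mem_stepH] at hj; omega) i
            simp only [Pi.add_apply, Pi.smul_apply, smul_eq_mul]
            convert! this using 2
            split_ifs <;> rfl) s
        rw [Matrix.mulVec_add, Matrix.mulVec_smul] at h1
        rw [← mul_assoc, ← zpow_add₀ hw.ne', show a + 1 + j = a + j + 1 by ring]
        convert! h1 using 1
        simp only [Pi.add_apply]
        congr 1
        split_ifs <;> simp
      have htot := Finset.sum_le_sum hbound
      rw [← Finset.mul_sum] at htot
      have htot' := htot.trans (mul_le_mul_of_nonneg_left (hh s) (zpow_nonneg hw.le _))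
      rw [Finset.sum_add_distrib] at htot'
      refine le_trans (le_of_eq ?_) htot'
      rw [hrec, if_neg ha.ne', add_zero, Matrix.add_mulVec, Pi.add_apply, Matrix.sum_mulVec,
        Finset.sum_apply]
      simp only [← Matrix.mulVec_mulVec]
      congr 1
      rw [sum_stepH]
      rcases eq_or_ne a 0 with rfl | hne
      · simp
      · simp [hne, show ¬ a + -1 = -1 by omega, show ¬ a = -1 by omega,
          show ¬ a + 1 = -1 by omega]

/-- The exit bound controls column `t` only if `B₋₁ h` is positive there. In general each path is
first prolonged by a fixed excursion of length `m` from `t` to a phase with a down step. -/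
theorem summable_qMatrix (hB : ∀ j ∈ stepH, ∀ s t, 0 ≤ B j s t) {w : ℝ} (hw : 0 < w)
    {h : S → ℝ} (hpos : ∀ i, 0 < h i)
    (hh : ∀ s, ∑ j ∈ stepH, w ^ j * (B j *ᵥ h) s ≤ h s)
    (hexit : ∀ t, ∃ t' t'', Relation.ReflTransGen (LevelStep B) (0, t) (0, t') ∧
      0 < B (-1) t' t'') : Summable (qMatrix B) := by
  simp only [funext (fun n => qMatrix_eq_tabooPow (B := B) n)]
  have hT := tabooPow_nonneg hB
  have b1 := hB (-1) (by decide)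
  refine Pi.summable.2 fun s => Pi.summable.2 fun t => ?_
  obtain ⟨t', t'', hpath, hdown⟩ := hexit t
  obtain ⟨m, hm⟩ := exists_tabooPow_pos hB hpath
  simp only [Nat.cast_zero] at hm
  set x : S → ℝ := B (-1) *ᵥ h with hx
  have hx0 : ∀ i, 0 ≤ x i := mulVec_entry_nonneg b1 fun i => (hpos i).le
  set y : S → ℝ := tabooPow B m 0 0 *ᵥ x with hy
  have hy0 : ∀ i, 0 ≤ y i := mulVec_entry_nonneg (hT m 0 0) hx0
  have hyt : 0 < y t := by
    refine Finset.sum_pos' (fun i _ => mul_nonneg (hT _ _ _ _ _) (hx0 i))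
      ⟨t', Finset.mem_univ _, mul_pos hm ?_⟩
    exact Finset.sum_pos' (fun i _ => mul_nonneg (b1 _ _) (hpos i).le)
      ⟨t'', Finset.mem_univ _, mul_pos hdown (hpos _)⟩
  refine summable_of_sum_range_le (c := w * h s / y t) (fun n => hT _ _ _ _ _) fun L => ?_
  rw [le_div_iff₀ hyt, Finset.sum_mul]
  have h1 := sum_tabooPow_mulVec_le hB hw hpos hh (m + L) 0 (by norm_num) s
  simp only [show ¬ (0 : ℤ) = -1 by norm_num, if_false, add_zero, zero_add, zpow_one,
    Matrix.sum_mulVec, Finset.sum_apply] at h1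
  -- The prolonged paths have lengths `m + n` with `n < L`, a subset of the lengths below `m + L`.
  refine le_trans (le_trans ?_ (Finset.sum_le_sum_of_subset_of_nonneg
    (s := (Finset.range L).image (m + ·)) ?_
    (fun n _ _ => mulVec_entry_nonneg (hT n 0 0) hx0 s))) h1
  · rw [Finset.sum_image fun _ _ _ _ => by simp]
    refine Finset.sum_le_sum fun n _ => ?_
    calc tabooPow B n 0 0 s t * y t ≤ (tabooPow B n 0 0 *ᵥ y) s :=
          Finset.single_le_sum (f := fun i => tabooPow B n 0 0 s i * y i)
            (fun i _ => mul_nonneg (hT _ _ _ _ _) (hy0 i)) (Finset.mem_univ t)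
      _ = ((tabooPow B n 0 0 * tabooPow B m 0 0) *ᵥ x) s := by rw [hy, Matrix.mulVec_mulVec]
      _ ≤ (tabooPow B (m + n) 0 0 *ᵥ x) s := by
          rw [add_comm m n]
          exact Finset.sum_le_sum fun i _ =>
            mul_le_mul_of_nonneg_right (tabooPow_mul_le hB n m 0 0 0 s i) (hx0 i)
  · intro n hn
    simp only [Finset.mem_image, Finset.mem_range] at hn ⊢
    obtain ⟨k, hk, rfl⟩ := hn
    omega

theorem nMatrix_nonneg (hB : ∀ j ∈ stepH, ∀ s t, 0 ≤ B j s t) (hs : Summable (qMatrix B))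
    (s t : S) : 0 ≤ nMatrix B s t := by
  refine HasSum.nonneg (fun n => ?_) (Pi.hasSum.1 (Pi.hasSum.1 hs.hasSum s) t)
  rw [qMatrix_eq_tabooPow]; exact tabooPow_nonneg hB n 0 0 s t

theorem nMatrix_pos_of_path (hB : ∀ j ∈ stepH, ∀ s t, 0 ≤ B j s t) (hs : Summable (qMatrix B))
    {s t : S} (h : Relation.ReflTransGen (LevelStep B) (0, s) (0, t)) : 0 < nMatrix B s t := by
  obtain ⟨n, hn⟩ := exists_tabooPow_pos hB h
  refine hn.trans_le ?_
  have := le_hasSum (Pi.hasSum.1 (Pi.hasSum.1 hs.hasSum s) t) n (fun n _ => by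
    rw [qMatrix_eq_tabooPow]; exact tabooPow_nonneg hB n 0 0 s t)
  rwa [qMatrix_eq_tabooPow] at this

/-- Induction on the last step: a path ending at level `0` is counted by `N` as a whole, and any
other last step is absorbed by `R`. -/
theorem nMatrix_mul_pow_pos_of_path (hB : ∀ j ∈ stepH, ∀ s t, 0 ≤ B j s t)
    (hs : Summable (qMatrix B)) {R : Matrix S S ℝ} (hR : IsRMatrix B R) {s : S} {y : ℕ × S}
    (h : Relation.ReflTransGen (LevelStep B) (0, s) y) :
    0 < (nMatrix B * R ^ y.1) s y.2 := by
  induction h with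
  | refl => simpa using nMatrix_pos_of_path hB hs Relation.ReflTransGen.refl
  | tail hp hstep ih =>
    rename_i y z
    rcases z with ⟨b, t⟩
    rcases Nat.eq_zero_or_pos b with rfl | hb
    · simpa using nMatrix_pos_of_path hB hs (hp.tail hstep)
    · obtain ⟨j, hj, hz, hpos⟩ := hstep
      exact hR.pos_of_step hB (nMatrix_nonneg hB hs) hj hz hb.ne' ih hpos

theorem gMatrix_pow_pos_of_path (hB : ∀ j ∈ stepH, ∀ s t, 0 ≤ B j s t)
    {G : Matrix S S ℝ} (hG : IsGMatrix B G) {x : ℕ × S} {t r : S}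
    (h : Relation.ReflTransGen (LevelStep B) x (0, t)) (hdown : 0 < B (-1) t r) :
    0 < (G ^ (x.1 + 1)) x.2 r := by
  induction h using Relation.ReflTransGen.head_induction_on with
  | refl => simpa using hG.pos_of_down hB hdown
  | head hstep _ ih =>
    obtain ⟨j, hj, hz, hpos⟩ := hstep
    exact hG.pos_of_step hB hj hz hpos ih

end TabooPaths

/-! ### Reachability and projections onto intervals -/

section Chains

theorem ReachIn.induction_forward {X : Type*} {P : X → X → ℝ} {I : X → Prop}
    (hI : ∀ x y, 0 < P x y → I x → I y) {n : ℕ} {x y : X} (h : ReachIn P n x y) (hx : I x) :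
    I y := by
  induction n generalizing x with
  | zero => exact h ▸ hx
  | succ n ih => obtain ⟨w, h1, h2⟩ := h; exact ih h2 (hI _ _ h1 hx)

theorem ReachIn.map {X Y : Type*} {P : X → X → ℝ} {Q : Y → Y → ℝ} (f : X → Y)
    (hf : ∀ x y, P x y = Q (f x) (f y)) {n : ℕ} {x y : X} (h : ReachIn P n x y) :
    ReachIn Q n (f x) (f y) := by
  induction n generalizing x with
  | zero => exact congrArg f h
  | succ n ih => obtain ⟨w, h1, h2⟩ := h; exact ⟨f w, hf x w ▸ h1, ih h2⟩

theorem ChainIrreducible.map {X Y : Type*} {P : X → X → ℝ} {Q : Y → Y → ℝ} (e : X ≃ Y)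
    (he : ∀ x y, P x y = Q (e x) (e y)) (h : ChainIrreducible P) : ChainIrreducible Q := by
  intro x y
  obtain ⟨n, hn⟩ := h (e.symm x) (e.symm y)
  exact ⟨n, by simpa using hn.map e he⟩

/-- A compact convex set of reals containing `0` contains the interval spanned by any of its
subsets, with the convention `sInf ∅ = sSup ∅ = 0`. -/
theorem Icc_sInf_sSup_subset {P Q : Set ℝ} (hPQ : P ⊆ Q) (hQ : IsCompact Q) (hc : Convex ℝ Q)
    (h0 : (0 : ℝ) ∈ Q) : Set.Icc (sInf P) (sSup P) ⊆ Q := by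
  refine hc.ordConnected.out ?_ ?_
  · rcases P.eq_empty_or_nonempty with rfl | hP
    · simpa using h0
    · exact hQ.isClosed.closure_subset_iff.2 hPQ
        (csInf_mem_closure hP (hQ.bddBelow.mono hPQ))
  · rcases P.eq_empty_or_nonempty with rfl | hP
    · simpa using h0
    · exact hQ.isClosed.closure_subset_iff.2 hPQ
        (csSup_mem_closure hP (hQ.bddAbove.mono hPQ))

end Chains

namespace TwoDQBD

/-! ### Powers of `C` along paths of the interior chain -/

section Interior

variable {S : Type*} [Fintype S] (q : TwoDQBD S)

theorem C_exp_apply (s₁ s₂ : ℝ) (s t : S) : q.C (Real.exp s₁) (Real.exp s₂) s t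
    = ∑ i ∈ stepH, ∑ j ∈ stepH, Real.exp (i * s₁ + j * s₂) * q.A i j s t := by
  have e : ∀ (k : ℤ) (x : ℝ), Real.exp (k * x) = Real.exp x ^ k := fun k x => by
    rw [← Real.rpow_intCast, ← Real.exp_mul, mul_comm]
  simp only [C, Matrix.sum_apply, Matrix.smul_apply, smul_eq_mul, Real.exp_add, e]

theorem C_exp_nonneg (s₁ s₂ : ℝ) (s t : S) : 0 ≤ q.C (Real.exp s₁) (Real.exp s₂) s t := by
  rw [C_exp_apply]
  exact Finset.sum_nonneg fun i hi => Finset.sum_nonneg fun j hj =>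
    mul_nonneg (Real.exp_pos _).le (q.A_nonneg i hi j hj s t)

theorem le_C_exp (s₁ s₂ : ℝ) {i j : ℤ} (hi : i ∈ stepH) (hj : j ∈ stepH) (s t : S) :
    Real.exp (i * s₁ + j * s₂) * q.A i j s t ≤ q.C (Real.exp s₁) (Real.exp s₂) s t := by
  rw [C_exp_apply]
  have h0 : ∀ i ∈ stepH, ∀ j ∈ stepH, 0 ≤ Real.exp (i * s₁ + j * s₂) * q.A i j s t :=
    fun i hi j hj => mul_nonneg (Real.exp_pos _).le (q.A_nonneg i hi j hj s t)
  exact (Finset.single_le_sum (f := fun j : ℤ => Real.exp (i * s₁ + j * s₂) * q.A i j s t)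
    (h0 i hi) hj).trans (Finset.single_le_sum
      (f := fun i : ℤ => ∑ j ∈ stepH, Real.exp (i * s₁ + j * s₂) * q.A i j s t)
      (fun i hi => Finset.sum_nonneg (h0 i hi)) hi)

theorem pos_of_chainInt_pos {x y : ℤ × ℤ × S} (h : 0 < q.chainInt x y) :
    y.1 - x.1 ∈ stepH ∧ y.2.1 - x.2.1 ∈ stepH ∧
      0 < q.A (y.1 - x.1) (y.2.1 - x.2.1) x.2.2 y.2.2 := by
  rw [chainInt] at h
  split_ifs at h with hc
  · exact ⟨hc.1, hc.2, h⟩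
  · exact absurd h (lt_irrefl _)

variable [DecidableEq S]

/-- The constant `p` is the probability of one path, and the exponential weights telescope to the
total displacement. That `p` does not depend on `(s₁, s₂)` is what later gives compactness. -/
theorem exists_le_C_pow_of_reachIn {n : ℕ} {x y : ℤ × ℤ × S} (h : ReachIn q.chainInt n x y) :
    ∃ p : ℝ, 0 < p ∧ ∀ s₁ s₂ : ℝ,
      p * Real.exp (((y.1 - x.1 : ℤ) : ℝ) * s₁ + ((y.2.1 - x.2.1 : ℤ) : ℝ) * s₂)
        ≤ (q.C (Real.exp s₁) (Real.exp s₂) ^ n) x.2.2 y.2.2 := by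
  induction n generalizing x with
  | zero =>
    obtain rfl : x = y := h
    exact ⟨1, one_pos, fun s₁ s₂ => by simp⟩
  | succ n ih =>
    obtain ⟨w, h1, h2⟩ := h
    obtain ⟨p, hp, hle⟩ := ih h2
    obtain ⟨hi, hj, hA⟩ := q.pos_of_chainInt_pos h1
    refine ⟨q.A (w.1 - x.1) (w.2.1 - x.2.1) x.2.2 w.2.2 * p, mul_pos hA hp, fun s₁ s₂ => ?_⟩
    rw [pow_succ', Matrix.mul_apply]
    refine le_trans (le_trans (le_of_eq ?_) (mul_le_mul (q.le_C_exp s₁ s₂ hi hj x.2.2 w.2.2)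
      (hle s₁ s₂) (by positivity) (q.C_exp_nonneg _ _ _ _)))
      (Finset.single_le_sum (f := fun t => q.C (Real.exp s₁) (Real.exp s₂) x.2.2 t *
        (q.C (Real.exp s₁) (Real.exp s₂) ^ n) t y.2.2)
        (fun t _ => mul_nonneg (q.C_exp_nonneg _ _ _ _)
          (pow_entry_nonneg (q.C_exp_nonneg _ _) _ _ _)) (Finset.mem_univ w.2.2))
    have : ((y.1 - x.1 : ℤ) : ℝ) * s₁ + ((y.2.1 - x.2.1 : ℤ) : ℝ) * s₂
        = (((w.1 - x.1 : ℤ) : ℝ) * s₁ + ((w.2.1 - x.2.1 : ℤ) : ℝ) * s₂) +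
          (((y.1 - w.1 : ℤ) : ℝ) * s₁ + ((y.2.1 - w.2.1 : ℤ) : ℝ) * s₂) := by
      push_cast; ring
    rw [this, Real.exp_add]
    ring

variable {q}

theorem exists_C_pow_pos (h_irr : ChainIrreducible q.chainInt) (s₁ s₂ : ℝ) (s t : S) :
    ∃ n, 0 < (q.C (Real.exp s₁) (Real.exp s₂) ^ n) s t := by
  obtain ⟨n, hn⟩ := h_irr (0, 0, s) (0, 0, t)
  obtain ⟨p, hp, hle⟩ := q.exists_le_C_pow_of_reachIn hn
  exact ⟨n, (mul_pos hp (Real.exp_pos _)).trans_le (hle s₁ s₂)⟩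

end Interior

/-! ### Subinvariant vectors in logarithmic coordinates -/

section Region

variable {S : Type*} [Fintype S] (q : TwoDQBD S)

/-- The points `(s₁, s₂, g)` for which `exp ∘ g` is subinvariant for `C(exp s₁, exp s₂)` and `g`
vanishes at the phase `o`. -/
def logSubinvariantSet (o : S) : Set (ℝ × ℝ × (S → ℝ)) :=
  {p | p.2.2 o = 0 ∧ ∀ s, ∑ i ∈ stepH, ∑ j ∈ stepH, ∑ t,
    q.A i j s t * Real.exp (i * p.1 + j * p.2.1 + p.2.2 t - p.2.2 s) ≤ 1}

theorem C_exp_mulVec_exp (s₁ s₂ : ℝ) (g : S → ℝ) (s : S) :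
    (q.C (Real.exp s₁) (Real.exp s₂) *ᵥ fun t => Real.exp (g t)) s =
      (∑ i ∈ stepH, ∑ j ∈ stepH, ∑ t,
        q.A i j s t * Real.exp (i * s₁ + j * s₂ + g t - g s)) * Real.exp (g s) := by
  simp only [Matrix.mulVec, dotProduct, C_exp_apply, Finset.sum_mul]
  rw [Finset.sum_comm]
  refine Finset.sum_congr rfl fun i _ => ?_
  rw [Finset.sum_comm]
  refine Finset.sum_congr rfl fun j _ => Finset.sum_congr rfl fun t _ => ?_
  rw [Real.exp_sub, Real.exp_add _ (g t)]
  field_simp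

theorem mem_logSubinvariantSet {o : S} {s₁ s₂ : ℝ} {g : S → ℝ} :
    (s₁, s₂, g) ∈ q.logSubinvariantSet o ↔ g o = 0 ∧
      ∀ s, (q.C (Real.exp s₁) (Real.exp s₂) *ᵥ fun t => Real.exp (g t)) s ≤ Real.exp (g s) := by
  simp only [logSubinvariantSet, Set.mem_ofPred_eq, C_exp_mulVec_exp]
  refine and_congr_right fun _ => forall_congr' fun s => ?_
  exact (mul_le_iff_le_one_left (Real.exp_pos _)).symm

theorem mem_logSubinvariantSet_of_pos (o : S) {s₁ s₂ : ℝ} {h : S → ℝ} (hpos : ∀ i, 0 < h i)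
    (hh : ∀ s, (q.C (Real.exp s₁) (Real.exp s₂) *ᵥ h) s ≤ h s) :
    (s₁, s₂, fun s => Real.log (h s / h o)) ∈ q.logSubinvariantSet o := by
  rw [mem_logSubinvariantSet]
  refine ⟨by simp [(hpos o).ne'], fun s => ?_⟩
  have e : ∀ s, Real.exp (Real.log (h s / h o)) = (h o)⁻¹ * h s := fun s => by
    rw [Real.exp_log (div_pos (hpos s) (hpos o)), div_eq_inv_mul]
  simp only [e]
  rw [show (fun t => (h o)⁻¹ * h t) = (h o)⁻¹ • h from rfl, Matrix.mulVec_smul]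
  exact mul_le_mul_of_nonneg_left (hh s) (inv_nonneg.2 (hpos o).le)

theorem convex_logSubinvariantSet (o : S) : Convex ℝ (q.logSubinvariantSet o) := by
  rintro ⟨x₁, x₂, x⟩ ⟨hx0, hx⟩ ⟨y₁, y₂, y⟩ ⟨hy0, hy⟩ a b ha hb hab
  simp only at hx0 hx hy0 hy
  refine ⟨by simp [hx0, hy0], fun s => ?_⟩
  have h1 : a * 1 + b * 1 = 1 := by linarith
  rw [← h1]
  refine le_trans ?_ (add_le_add (mul_le_mul_of_nonneg_left (hx s) ha)
    (mul_le_mul_of_nonneg_left (hy s) hb))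
  simp only [Finset.mul_sum, ← Finset.sum_add_distrib]
  refine Finset.sum_le_sum fun i hi => Finset.sum_le_sum fun j hj => Finset.sum_le_sum
    fun t _ => ?_
  have hc := convexOn_exp.2 (Set.mem_univ (i * x₁ + j * x₂ + x t - x s))
    (Set.mem_univ (i * y₁ + j * y₂ + y t - y s)) ha hb hab
  simp only [smul_eq_mul] at hc
  have hm := mul_le_mul_of_nonneg_left hc (q.A_nonneg i hi j hj s t)
  simp only [Prod.smul_mk, Prod.mk_add_mk, Pi.add_apply, Pi.smul_apply, smul_eq_mul]
  refine le_trans (le_of_eq ?_) (hm.trans (le_of_eq ?_))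
  · congr 2; ring
  · ring

theorem isClosed_logSubinvariantSet (o : S) : IsClosed (q.logSubinvariantSet o) := by
  rw [logSubinvariantSet, Set.ofPred_and, Set.ofPred_forall]
  exact (isClosed_eq (by fun_prop) continuous_const).inter
    (isClosed_iInter fun s => isClosed_le (by fun_prop) continuous_const)

-- A path from phase `s` to phase `t` with displacement `(y₁, y₂)` bounds `y₁ s₁ + y₂ s₂ + g t - g
-- s` above. Unit displacements in both directions at `o` bound `s₁` and `s₂`; zero displacement
-- between `o` and `s` bounds `g s`, since `g o = 0`.
variable {q} in
theorem isCompact_logSubinvariantSet [DecidableEq S] (h_irr : ChainIrreducible q.chainInt)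
    (o : S) : IsCompact (q.logSubinvariantSet o) := by
  have hreach : ∀ (y₁ y₂ : ℤ) (s t : S), ∃ p : ℝ, 0 < p ∧ ∀ s₁ s₂ g,
      (s₁, s₂, g) ∈ q.logSubinvariantSet o → y₁ * s₁ + y₂ * s₂ + g t - g s ≤ - Real.log p := by
    intro y₁ y₂ s t
    obtain ⟨n, hn⟩ := h_irr (0, 0, s) (y₁, y₂, t)
    obtain ⟨p, hp, hle⟩ := q.exists_le_C_pow_of_reachIn hn
    refine ⟨p, hp, fun s₁ s₂ g hg => ?_⟩
    rw [mem_logSubinvariantSet] at hg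
    have h1 := pow_mulVec_le (q.C_exp_nonneg s₁ s₂) hg.2 n s
    have h2 := (Finset.single_le_sum
      (f := fun t => (q.C (Real.exp s₁) (Real.exp s₂) ^ n) s t * Real.exp (g t))
      (fun t _ => mul_nonneg (pow_entry_nonneg (q.C_exp_nonneg _ _) _ _ _) (Real.exp_pos _).le)
      (Finset.mem_univ t)).trans h1
    have h3 := (mul_le_mul_of_nonneg_right (hle s₁ s₂) (Real.exp_pos (g t)).le).trans h2
    simp only [sub_zero] at h3
    rw [← Real.exp_log hp, ← Real.exp_add, ← Real.exp_add, Real.exp_le_exp] at h3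
    linarith
  choose p _ hple using hreach
  refine (isCompact_Icc (a := (Real.log (p (-1) 0 o o), Real.log (p 0 (-1) o o),
      fun s => Real.log (p 0 0 s o)))
    (b := (-Real.log (p 1 0 o o), -Real.log (p 0 1 o o),
      fun s => -Real.log (p 0 0 o s)))).of_isClosed_subset (q.isClosed_logSubinvariantSet o) ?_
  rintro ⟨s₁, s₂, g⟩ hg
  have H := fun y₁ y₂ s t => hple y₁ y₂ s t s₁ s₂ g hg
  have g0 := hg.1
  simp only at g0
  refine ⟨⟨?_, ?_, fun s => ?_⟩, ⟨?_, ?_, fun s => ?_⟩⟩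
  · have := H (-1) 0 o o; push_cast at this; simp only; linarith
  · have := H 0 (-1) o o; push_cast at this; simp only; linarith
  · have := H 0 0 s o; push_cast at this; simp only; linarith
  · have := H 1 0 o o; push_cast at this; simp only; linarith
  · have := H 0 1 o o; push_cast at this; simp only; linarith
  · have := H 0 0 o s; push_cast at this; simp only; linarith

theorem zero_mem_logSubinvariantSet (o : S) : (0, 0, 0) ∈ q.logSubinvariantSet o := by
  refine ⟨rfl, fun s => le_of_eq ?_⟩
  rw [← q.A_stochastic s]
  simp only [mul_zero, add_zero, Pi.zero_apply, sub_zero, Real.exp_zero, mul_one,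
    Matrix.sum_apply]
  rw [Finset.sum_comm (s := Finset.univ)]
  refine Finset.sum_congr rfl fun i _ => ?_
  rw [Finset.sum_comm]

variable {q} in
/-- Every `z` in the closed interval spanned by the projection of the region `χ ≤ 1` admits a
`w` and a positive vector that is subinvariant for `C(z, w)`. -/
theorem exists_pos_subinvariant [DecidableEq S] [Nonempty S]
    (h_irr : ChainIrreducible q.chainInt) {z : ℝ} (hz : z ∈ Set.Icc q.zLow1 q.zHigh1) :
    0 < z ∧ ∃ w : ℝ, 0 < w ∧ ∃ h : S → ℝ, (∀ i, 0 < h i) ∧ (∀ s, (q.C z w *ᵥ h) s ≤ h s) := by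
  have hz0 : 0 < z := (Real.exp_pos _).trans_le hz.1
  let o : S := Classical.arbitrary S
  have hsub : Prod.fst '' q.Gam ⊆ Prod.fst '' q.logSubinvariantSet o := by
    rintro _ ⟨⟨s₁, s₂⟩, hs, rfl⟩
    have hnn := q.C_exp_nonneg s₁ s₂
    obtain ⟨h, h0, hsum, hle, -⟩ := exists_subinvariant_of_summable (y := fun _ => 1) hnn
      (fun r hr0 hr1 => summable_smul_pow_of_spr_le_one hs hr0 hr1) (fun _ => zero_le_one)
      ⟨o, one_pos⟩
    exact ⟨_, q.mem_logSubinvariantSet_of_pos o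
      (pos_of_subinvariant hnn (exists_C_pow_pos h_irr s₁ s₂) h0 hsum hle) hle, rfl⟩
  have hmem : Real.log z ∈ Set.Icc (sInf (Prod.fst '' q.Gam)) (sSup (Prod.fst '' q.Gam)) :=
    ⟨(Real.le_log_iff_exp_le hz0).2 hz.1, (Real.log_le_iff_le_exp hz0).2 hz.2⟩
  -- Only the inclusion of projections is used, so neither closedness nor nonemptiness of the region
  -- `χ ≤ 1` has to be known.
  obtain ⟨⟨s₁, s₂, g⟩, hg, hs₁⟩ := Icc_sInf_sSup_subset hsub
    ((isCompact_logSubinvariantSet h_irr o).image continuous_fst)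
    ((q.convex_logSubinvariantSet o).linear_image (LinearMap.fst ℝ ℝ (ℝ × (S → ℝ))))
    ⟨_, q.zero_mem_logSubinvariantSet o, rfl⟩ hmem
  simp only at hs₁
  rw [mem_logSubinvariantSet, hs₁, Real.exp_log hz0] at hg
  exact ⟨hz0, Real.exp s₂, Real.exp_pos _, fun t => Real.exp (g t), fun _ => Real.exp_pos _, hg.2⟩

end Region

/-! ### Positivity on and above the axis -/

section Boundary

variable {S : Type*} [Fintype S] (q : TwoDQBD S)

theorem C_eq_sum_Acol (z w : ℝ) : q.C z w = ∑ j ∈ stepH, w ^ j • q.Acol z j := by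
  simp only [C, Acol, Finset.smul_sum, smul_smul]
  rw [Finset.sum_comm]
  simp only [mul_comm]

theorem Acol_nonneg {z : ℝ} (hz : 0 < z) : ∀ j ∈ stepH, ∀ s t, 0 ≤ q.Acol z j s t :=
  fun j hj s t => by
    rw [Acol, Matrix.sum_apply]
    exact Finset.sum_nonneg fun i hi => mul_nonneg (zpow_nonneg hz.le _) (q.A_nonneg i hi j hj s t)

theorem A1col_nonneg {z : ℝ} (hz : 0 < z) : ∀ j ∈ stepHPos, ∀ s t, 0 ≤ q.A1col z j s t :=
  fun j hj s t => by
    rw [A1col, Matrix.sum_apply]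
    exact Finset.sum_nonneg fun i hi =>
      mul_nonneg (zpow_nonneg hz.le _) (q.A1_nonneg i hi j hj s t)

theorem Acol_pos {z : ℝ} (hz : 0 < z) {i j : ℤ} (hi : i ∈ stepH) (hj : j ∈ stepH) {s t : S}
    (h : 0 < q.A i j s t) : 0 < q.Acol z j s t := by
  rw [Acol, Matrix.sum_apply]
  exact Finset.sum_pos' (fun i hi => mul_nonneg (zpow_nonneg hz.le _) (q.A_nonneg i hi j hj s t))
    ⟨i, hi, mul_pos (zpow_pos hz _) h⟩

theorem A1col_pos {z : ℝ} (hz : 0 < z) {i j : ℤ} (hi : i ∈ stepH) (hj : j ∈ stepHPos) {s t : S}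
    (h : 0 < q.A1 i j s t) : 0 < q.A1col z j s t := by
  rw [A1col, Matrix.sum_apply]
  exact Finset.sum_pos'
    (fun i hi => mul_nonneg (zpow_nonneg hz.le _) (q.A1_nonneg i hi j hj s t))
    ⟨i, hi, mul_pos (zpow_pos hz _) h⟩

/-- Levels drop by at most one per step, so the first visit below zero is a down step from level
`0`. -/
theorem exists_exit_of_reachIn {z : ℝ} (hz : 0 < z) {n : ℕ} {x y : ℤ × ℤ × S}
    (h : ReachIn q.chainInt n x y) (hy : y.2.1 < 0) {a : ℕ} (ha : x.2.1 = a) :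
    ∃ t' t'', Relation.ReflTransGen (LevelStep (q.Acol z)) (a, x.2.2) (0, t') ∧
      0 < q.Acol z (-1) t' t'' := by
  induction n generalizing x a with
  | zero => obtain rfl : x = y := h; omega
  | succ n ih =>
    obtain ⟨w, h1, h2⟩ := h
    obtain ⟨hi, hj, hA⟩ := q.pos_of_chainInt_pos h1
    have hpos := q.Acol_pos hz hi hj hA
    rcases lt_or_ge w.2.1 0 with hw | hw
    · have hj' := mem_stepH.1 hj
      obtain rfl : a = 0 := by omega
      rw [show w.2.1 - x.2.1 = -1 by omega] at hpos
      exact ⟨_, _, Relation.ReflTransGen.refl, hpos⟩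
    · obtain ⟨b, hb⟩ := Int.eq_ofNat_of_zero_le hw
      obtain ⟨t', t'', hp, hd⟩ := ih h2 hb
      exact ⟨t', t'', hp.head ⟨_, hj, by simp only; omega, hpos⟩, hd⟩

variable [DecidableEq S]

theorem C1_nonneg {z : ℝ} (hz : 0 < z) (hG : ∀ s t, 0 ≤ gMatrix (q.Acol z) s t) (s t : S) :
    0 ≤ q.C1 z s t :=
  add_nonneg (q.A1col_nonneg hz 0 (by decide) s t)
    (mul_entry_nonneg (q.A1col_nonneg hz 1 (by decide)) hG s t)

variable {q}

/-- Along the chain reflected at `x₂ = 0`, positivity of an invariant vector of `C₁` propagates: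
on the axis as positivity of `u`, and above it as a path from the support of `u A⁽¹⁾_{*,1}`. -/
theorem boundary_positivity (h_irr1 : ChainIrreducible q.chainOne) {z : ℝ} (hz : 0 < z)
    (hG : IsGMatrix (q.Acol z) (gMatrix (q.Acol z))) {u : S → ℝ} (hu : ∀ i, 0 ≤ u i)
    (hu0 : ∃ i, 0 < u i) (huC : u ᵥ* q.C1 z = u) (b : ℕ) (t : S) :
    (b = 0 ∧ 0 < u t) ∨ ∃ c, b = c + 1 ∧ ∃ r, 0 < (u ᵥ* q.A1col z 1) r ∧
      Relation.ReflTransGen (LevelStep (q.Acol z)) (0, r) (c, t) := by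
  obtain ⟨s, hs⟩ := hu0
  obtain ⟨n, hn⟩ := h_irr1 (0, 0, s) (0, b, t)
  have a0 := q.A1col_nonneg hz 0 (by decide)
  have a1 := q.A1col_nonneg hz 1 (by decide)
  have hB := q.Acol_nonneg hz
  have hsplit : ∀ t, u t = (u ᵥ* q.A1col z 0) t + ((u ᵥ* q.A1col z 1) ᵥ* gMatrix (q.Acol z)) t :=
    fun t => by
      conv_lhs => rw [← huC]
      rw [C1, Matrix.vecMul_add, Matrix.vecMul_vecMul]; rfl
  refine hn.induction_forward (I := fun x : ℤ × ℕ × S => (x.2.1 = 0 ∧ 0 < u x.2.2) ∨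
    ∃ c, x.2.1 = c + 1 ∧ ∃ r, 0 < (u ᵥ* q.A1col z 1) r ∧
      Relation.ReflTransGen (LevelStep (q.Acol z)) (0, r) (c, x.2.2)) ?_ (Or.inl ⟨rfl, hs⟩)
  rintro ⟨x, a, t⟩ ⟨y, b, t'⟩ hstep
  simp only [chainOne] at hstep
  rintro (⟨rfl, hut⟩ | ⟨c, rfl, r, hr, hp⟩)
  · simp only [ne_eq, not_true_eq_false, if_false] at hut hstep
    split_ifs at hstep with hc
    · have hpos := q.A1col_pos hz hc.1 hc.2 hstep
      have hb : b = 0 ∨ b = 1 := by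
        have := hc.2; simp only [stepHPos, Finset.mem_insert, Finset.mem_singleton] at this; omega
      rcases hb with rfl | rfl
      · left
        refine ⟨rfl, ?_⟩
        simp only at hpos ⊢
        rw [hsplit]
        refine add_pos_of_pos_of_nonneg (vecMul_entry_pos hu a0 hut (by simpa using hpos)) ?_
        exact vecMul_entry_nonneg (vecMul_entry_nonneg hu a1) hG.1 _
      · right
        exact ⟨0, rfl, t', vecMul_entry_pos hu a1 hut (by simpa using hpos),
          Relation.ReflTransGen.refl⟩
    · exact absurd hstep (lt_irrefl _)
  · simp only [ne_eq, Nat.succ_ne_zero, not_false_eq_true, if_true] at hp hstep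
    split_ifs at hstep with hc
    · have hpos := q.Acol_pos hz hc.1 hc.2 hstep
      have hj := mem_stepH.1 hc.2
      push_cast at hj
      rcases Nat.eq_zero_or_pos b with rfl | hb
      · left
        refine ⟨rfl, ?_⟩
        obtain rfl : c = 0 := by omega
        -- The excursion closes: its path from `(0, r)` and the final down step make `G r t'`
        -- positive.
        have hg := gMatrix_pow_pos_of_path hB hG hp (r := t') (by simpa using hpos)
        simp only [zero_add, pow_one] at hg ⊢
        rw [hsplit]
        exact add_pos_of_nonneg_of_pos (vecMul_entry_nonneg hu a0 _)
          (vecMul_entry_pos (vecMul_entry_nonneg hu a1) hG.1 hr hg)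
      · right
        obtain ⟨d, rfl⟩ := Nat.exists_eq_succ_of_ne_zero hb.ne'
        exact ⟨d, rfl, r, hr, hp.tail ⟨_, hc.2, by push_cast; ring, hpos⟩⟩
    · exact absurd hstep (lt_irrefl _)

theorem positivity_on_axis_one [Nonempty S] (h_irr : ChainIrreducible q.chainInt)
    (h_irr1 : ChainIrreducible q.chainOne) {z : ℝ} (hz : z ∈ Set.Icc q.zLow1 q.zHigh1)
    (hpsi : q.psi1 z = 1) :
    IsGMatrix (q.Acol z) (gMatrix (q.Acol z)) ∧
    IsRMatrix (q.Acol z) (rMatrix (q.Acol z)) ∧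
    Summable (qMatrix (q.Acol z)) ∧
    (∃ u v : S → ℝ, IsPerronPair (q.C1 z) u v) ∧
    ∀ u v : S → ℝ, IsPerronPair (q.C1 z) u v →
      (∀ j, 0 < u j) ∧
      ∀ (k : ℕ) (j : S),
        0 < (u ᵥ* (q.A1col z 1 * nMatrix (q.Acol z) * rMatrix (q.Acol z) ^ k)) j := by
  obtain ⟨hz0, w, hw, h, hpos, hh⟩ := exists_pos_subinvariant h_irr hz
  have hB := q.Acol_nonneg hz0
  have hpsi' : spr (q.C1 z) = 1 := hpsi
  have hh' : ∀ s, ∑ j ∈ stepH, w ^ j * (q.Acol z j *ᵥ h) s ≤ h s := fun s => by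
    refine le_trans (le_of_eq ?_) (hh s)
    rw [C_eq_sum_Acol, Matrix.sum_mulVec, Finset.sum_apply]
    simp only [Matrix.smul_mulVec, Pi.smul_apply, smul_eq_mul]
  have hCnn := q.C_exp_nonneg (Real.log z) (Real.log w)
  have hCirr := exists_C_pow_pos h_irr (Real.log z) (Real.log w)
  rw [Real.exp_log hz0, Real.exp_log hw] at hCnn hCirr
  obtain ⟨p, hp0, hpsum, hp⟩ := exists_left_subinvariant hCnn hpos hh
  have hppos : ∀ i, 0 < p i := pos_of_subinvariant (M := (q.C z w)ᵀ) (fun i j => hCnn j i)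
    (fun i j => by
      obtain ⟨n, hn⟩ := hCirr j i
      exact ⟨n, by rwa [← Matrix.transpose_pow]⟩) hp0 hpsum
    (fun i => by simpa [Matrix.mulVec_transpose] using hp i)
  have hp' : ∀ s, ∑ j ∈ stepH, w ^ j * (p ᵥ* q.Acol z j) s ≤ p s := fun s => by
    refine le_trans (le_of_eq ?_) (hp s)
    rw [C_eq_sum_Acol, Matrix.vecMul_sum, Finset.sum_apply]
    simp only [Matrix.vecMul_smul, Pi.smul_apply, smul_eq_mul]
  have hG : IsGMatrix (q.Acol z) (gMatrix (q.Acol z)) :=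
    Classical.epsilon_spec (exists_isGMatrix hB hw hpos hh')
  have hR : IsRMatrix (q.Acol z) (rMatrix (q.Acol z)) :=
    Classical.epsilon_spec (exists_isRMatrix hB hw hppos hp')
  have hN : Summable (qMatrix (q.Acol z)) := summable_qMatrix hB hw hpos hh' fun t => by
    obtain ⟨n, hn⟩ := h_irr (0, 0, t) (0, -1, t)
    exact q.exists_exit_of_reachIn hz0 hn (by norm_num) rfl
  have hupos : ∀ u : S → ℝ, (∀ i, 0 ≤ u i) → (∃ i, 0 < u i) → u ᵥ* q.C1 z = u → ∀ j, 0 < u j := by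
    intro u hu hu0 huC j
    rcases boundary_positivity h_irr1 hz0 hG hu hu0 huC 0 j with h | ⟨c, hc, -⟩
    · exact h.2
    · omega
  have hC1 := q.C1_nonneg hz0 hG.1
  have hex : ∀ x : S → ℝ, ∑ i, x i = 1 → ∃ i, 0 < x i := fun x hx => by
    by_contra! hcon
    linarith [Finset.sum_nonpos fun i (_ : i ∈ Finset.univ) => hcon i]
  refine ⟨hG, hR, hN, ?_, fun u v huv => ?_⟩
  · obtain ⟨v, hv0, hvsum, hv⟩ := exists_invariant_of_spr_eq_one hC1 hpsi'
    obtain ⟨u, hu0, husum, hu⟩ := exists_invariant_of_spr_eq_one (M := (q.C1 z)ᵀ)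
      (fun i j => hC1 j i) (by rw [spr_transpose, hpsi'])
    rw [Matrix.mulVec_transpose] at hu
    -- Strict positivity of `u` makes `u ⬝ᵥ v` positive, so the pair can be normalized.
    have hu1 := hupos u hu0 (hex u husum) hu
    obtain ⟨i, hi⟩ := hex v hvsum
    have hdot : 0 < u ⬝ᵥ v := Finset.sum_pos' (fun i _ => mul_nonneg (hu0 i) (hv0 i))
      ⟨i, Finset.mem_univ i, mul_pos (hu1 i) hi⟩
    refine ⟨u, (u ⬝ᵥ v)⁻¹ • v, hu0, fun j => mul_nonneg (inv_nonneg.2 hdot.le) (hv0 j), ?_, ?_, ?_⟩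
    · rw [hpsi', one_smul, hu]
    · rw [hpsi', one_smul, Matrix.mulVec_smul, hv]
    · rw [dotProduct_smul, smul_eq_mul, inv_mul_cancel₀ hdot.ne']
  · have hu0 : ∃ i, 0 < u i := by
      by_contra! hcon
      have : u = 0 := funext fun i => le_antisymm (hcon i) (huv.left_nonneg i)
      simpa [this] using huv.normalized
    have huC : u ᵥ* q.C1 z = u := by rw [huv.left_eigen, hpsi', one_smul]
    refine ⟨hupos u huv.left_nonneg hu0 huC, fun k j => ?_⟩
    -- Levels in `LevelStep` are measured from `x₂ = 1`, so the power `R ^ k` belongs to level `k +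
    -- 1` of the chain.
    rcases boundary_positivity h_irr1 hz0 hG huv.left_nonneg hu0 huC (k + 1) j with
      ⟨hk, -⟩ | ⟨c, hc, r, hr, hpath⟩
    · omega
    · obtain rfl : k = c := by omega
      rw [mul_assoc, ← Matrix.vecMul_vecMul]
      exact vecMul_entry_pos
        (vecMul_entry_nonneg huv.left_nonneg (q.A1col_nonneg hz0 1 (by decide)))
        (mul_entry_nonneg (nMatrix_nonneg hB hN) (pow_entry_nonneg hR.1 k)) hr
        (nMatrix_mul_pow_pos_of_path hB hN hR hpath)

end Boundary

/-! ### Exchange of the two coordinates -/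

section Swap

variable {S : Type*} [Fintype S] (q : TwoDQBD S)

/-- The process with the two coordinates of the level exchanged. -/
def swap : TwoDQBD S where
  A i j := q.A j i
  A1 i j := q.A2 j i
  A2 i j := q.A1 j i
  A0 i j := q.A0 j i
  A_nonneg i hi j hj := q.A_nonneg j hj i hi
  A1_nonneg i hi j hj := q.A2_nonneg j hj i hi
  A2_nonneg i hi j hj := q.A1_nonneg j hj i hi
  A0_nonneg i hi j hj := q.A0_nonneg j hj i hi
  A_stochastic s := by rw [Finset.sum_comm]; exact q.A_stochastic s
  A1_stochastic s := by rw [Finset.sum_comm]; exact q.A2_stochastic s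
  A2_stochastic s := by rw [Finset.sum_comm]; exact q.A1_stochastic s
  A0_stochastic s := by rw [Finset.sum_comm]; exact q.A0_stochastic s

theorem swap_C (z w : ℝ) : q.swap.C z w = q.C w z := by
  simp only [C, swap]
  rw [Finset.sum_comm]
  simp only [mul_comm]

theorem fst_image_swap_Gam [DecidableEq S] : Prod.fst '' q.swap.Gam = Prod.snd '' q.Gam := by
  ext x
  simp only [Set.mem_image, Gam, chi, swap_C, Set.mem_ofPred_eq, Prod.exists, exists_and_right,
    exists_eq_right]

variable {q}

theorem chainIrreducible_swap_chainInt (h : ChainIrreducible q.chainInt) :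
    ChainIrreducible q.swap.chainInt :=
  h.map ⟨fun x => (x.2.1, x.1, x.2.2), fun x => (x.2.1, x.1, x.2.2), fun _ => rfl, fun _ => rfl⟩
    fun x y => by simp only [chainInt, swap, Equiv.coe_fn_mk, and_comm]

theorem chainIrreducible_swap_chainOne (h : ChainIrreducible q.chainTwo) :
    ChainIrreducible q.swap.chainOne :=
  h.map ⟨fun x => (x.2.1, x.1, x.2.2), fun x => (x.2.1, x.1, x.2.2), fun _ => rfl, fun _ => rfl⟩
    fun x y => by simp only [chainOne, chainTwo, swap, Equiv.coe_fn_mk, and_comm]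

end Swap

end TwoDQBD

theorem proposition5p10 {S : Type*} [Fintype S] [DecidableEq S] [Nonempty S] (q : TwoDQBD S)
    (h_irr : ChainIrreducible q.chainInt) (h_aper : ChainAperiodic q.chainInt)
    (h_irr1 : ChainIrreducible q.chainOne) (h_aper1 : ChainAperiodic q.chainOne)
    (h_irr2 : ChainIrreducible q.chainTwo) (h_aper2 : ChainAperiodic q.chainTwo) :
    (∀ z₀ ∈ Set.Icc q.zLow1 q.zHigh1, q.psi1 z₀ = 1 →
      -- the objects in the claim are well defined
      IsGMatrix (q.Acol z₀) (gMatrix (q.Acol z₀)) ∧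
      IsRMatrix (q.Acol z₀) (rMatrix (q.Acol z₀)) ∧
      Summable (qMatrix (q.Acol z₀)) ∧
      (∃ u v : S → ℝ, IsPerronPair (q.C1 z₀) u v) ∧
      -- the claim
      ∀ u v : S → ℝ, IsPerronPair (q.C1 z₀) u v →
        (∀ j, 0 < u j) ∧
        ∀ (k : ℕ) (j : S),
          0 < (u ᵥ* (q.A1col z₀ 1 * nMatrix (q.Acol z₀) * rMatrix (q.Acol z₀) ^ k)) j) ∧
    (∀ w₀ ∈ Set.Icc q.zLow2 q.zHigh2, q.psi2 w₀ = 1 →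
      IsGMatrix (q.Arow w₀) (gMatrix (q.Arow w₀)) ∧
      IsRMatrix (q.Arow w₀) (rMatrix (q.Arow w₀)) ∧
      Summable (qMatrix (q.Arow w₀)) ∧
      (∃ u v : S → ℝ, IsPerronPair (q.C2 w₀) u v) ∧
      ∀ u v : S → ℝ, IsPerronPair (q.C2 w₀) u v →
        (∀ j, 0 < u j) ∧
        ∀ (k : ℕ) (j : S),
          0 < (u ᵥ* (q.A2row w₀ 1 * nMatrix (q.Arow w₀) * rMatrix (q.Arow w₀) ^ k)) j) := by
  refine ⟨fun z₀ hz₀ hpsi => TwoDQBD.positivity_on_axis_one h_irr h_irr1 hz₀ hpsi,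
    fun w₀ hw₀ hpsi => TwoDQBD.positivity_on_axis_one (q := q.swap)
      (TwoDQBD.chainIrreducible_swap_chainInt h_irr)
      (TwoDQBD.chainIrreducible_swap_chainOne h_irr2) ?_ hpsi⟩
  -- The other notions for the swapped process unfold to those of the second axis; only the
  -- interval, a projection of the reflected region, needs an argument.
  rwa [TwoDQBD.zLow1, TwoDQBD.zHigh1, TwoDQBD.fst_image_swap_Gam]
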